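/- Let $K$ be a field, $A=K[X_1,\dots,X_n]$ with the standard grading, $\mathbf m=(X_1,\dots,X_n)$, and let $F=\bigoplus_{k=1}^m A e_k$ be a graded free $A$-module of finite rank with $\deg e_k=d_k\in\mathbb Z$. Let $\omega\in\mathbb Z_{\ge 0}^n$ and $\epsilon\in\mathbb Z_{\ge 0}^m$, and give the monomial $X^u e_k$ of $F$ the weight $\omega\cdot u+\epsilon_k$. For $0\ne f\in F$ let $\operatorname{in}_{(\omega,\epsilon)}(f)$ be the sum of the terms of $f$ of largest weight, and for a submodule $M\subseteq F$ let $\operatorname{in}_{(\omega,\epsilon)}(M)$ be the submodule of $F$ generated by all $\operatorname{in}_{(\omega,\epsilon)}(f)$ with $0\ne f\in M$. For a finitely generated graded $A$-module $N$, let $\beta_i(N)$ be the rank of the $i$-th free module in a minimal graded free resolution of $N$, let $\beta_{ij}(N)$ be the number of its basis elements of degree $j$, and let $\operatorname{reg}(N)=\sup\{j-i:\beta_{ij}(N)\neq 0\}$ (so $\operatorname{reg}(0)=-\infty$). For $a\in\mathbb Z$ let $N_{\langle a\rangle}$ be the submodule of $N$ generated by its homogeneous elements of degree $a$; $N$ is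 called componentwise linear if $\operatorname{reg}(N_{\langle a\rangle})\le a$ for all $a\in\mathbb Z$. Let $M\subseteq F$ be a (necessarily finitely generated) graded submodule such that $\operatorname{in}_{(\omega,\epsilon)}(M)$ is componentwise linear. If $\beta_0(M)=\beta_0(\operatorname{in}_{(\omega,\epsilon)}(M))$, then $M$ is componentwise linear. -/

import Mathlib

open MvPolynomial

noncomputable section

namespace GradedFree

variable {K : Type*} [Field K] {n : ℕ}

/-- The graded free module `⨁ₖ A(-dₖ)` over `A = K[X₁, …, Xₙ]` is `Fin m → A`, where the basis vector
`eₖ` has degree `D k`. This is its component of degree `j`: the `k`-th coordinate of an element is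
a form of degree `j - D k` (hence zero if `j < D k`). -/
def degreePart (K : Type*) [Field K] (n : ℕ) {m : ℕ} (D : Fin m → ℤ) (j : ℤ) :
    Submodule K (Fin m → MvPolynomial (Fin n) K) :=
  Submodule.pi Set.univ
    (fun k => weightedHomogeneousSubmodule K (fun _ : Fin n => (1 : ℤ)) (j - D k))

/-- The degree `j` component of an element `f`. -/
def degreeComponent {m : ℕ} (D : Fin m → ℤ) (j : ℤ) (f : Fin m → MvPolynomial (Fin n) K) :
    Fin m → MvPolynomial (Fin n) K :=
  fun k => weightedHomogeneousComponent (fun _ : Fin n => (1 : ℤ)) (j - D k) (f k)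

/-- A graded submodule: it contains every homogeneous component of each of its elements. -/
def IsGraded {m : ℕ} (D : Fin m → ℤ)
    (M : Submodule (MvPolynomial (Fin n) K) (Fin m → MvPolynomial (Fin n) K)) : Prop :=
  ∀ f ∈ M, ∀ j : ℤ, degreeComponent D j f ∈ M

/-- The submodule `M_⟨a⟩` of `M` generated by the elements of `M` of degree `a`. -/
def generatedInDegree {m : ℕ} (D : Fin m → ℤ) (a : ℤ)
    (M : Submodule (MvPolynomial (Fin n) K) (Fin m → MvPolynomial (Fin n) K)) :
    Submodule (MvPolynomial (Fin n) K) (Fin m → MvPolynomial (Fin n) K) :=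
  Submodule.span (MvPolynomial (Fin n) K) {f | f ∈ M ∧ f ∈ degreePart K n D a}

/-! ### Initial modules -/

/-- The largest weight of a monomial in the support of `f`, the monomial `X ^ u • eₖ` having
weight `ω ⬝ u + ε k` (and `0` if `f = 0`). -/
def maxWeight {m : ℕ} (ω : Fin n → ℕ) (ε : Fin m → ℕ)
    (f : Fin m → MvPolynomial (Fin n) K) : ℕ :=
  Finset.univ.sup (fun k => (f k).support.sup (fun u => Finsupp.weight ω u + ε k))

/-- The initial part of `f`: the sum of its terms of largest weight. -/
def initialPart {m : ℕ} (ω : Fin n → ℕ) (ε : Fin m → ℕ)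
    (f : Fin m → MvPolynomial (Fin n) K) : Fin m → MvPolynomial (Fin n) K :=
  fun k => ∑ u ∈ (f k).support with Finsupp.weight ω u + ε k = maxWeight ω ε f,
    monomial u (coeff u (f k))

/-- The initial module of `M`. -/
def initialModule {m : ℕ} (ω : Fin n → ℕ) (ε : Fin m → ℕ)
    (M : Submodule (MvPolynomial (Fin n) K) (Fin m → MvPolynomial (Fin n) K)) :
    Submodule (MvPolynomial (Fin n) K) (Fin m → MvPolynomial (Fin n) K) :=
  Submodule.span (MvPolynomial (Fin n) K) (initialPart ω ε '' (M : Set _))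

/-! ### Betti numbers and regularity -/

/-- A minimal graded free resolution `⋯ → F₁ → F₀ → N → 0` of a submodule `N` of a graded free
module, with `Fᵢ` free on `rank i` basis elements, the `k`-th of degree `shift i k`. -/
structure MinimalGradedFreeResolution {m : ℕ} (D : Fin m → ℤ)
    (N : Submodule (MvPolynomial (Fin n) K) (Fin m → MvPolynomial (Fin n) K)) where
  rank : ℕ → ℕ
  shift : (i : ℕ) → Fin (rank i) → ℤ
  /-- The augmentation `F₀ → N`, composed with the inclusion of `N`. -/
  aug : (Fin (rank 0) → MvPolynomial (Fin n) K) →ₗ[MvPolynomial (Fin n) K]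
    (Fin m → MvPolynomial (Fin n) K)
  d : (i : ℕ) → (Fin (rank (i + 1)) → MvPolynomial (Fin n) K) →ₗ[MvPolynomial (Fin n) K]
    (Fin (rank i) → MvPolynomial (Fin n) K)
  aug_homogeneous : ∀ k, aug (Pi.single k 1) ∈ degreePart K n D (shift 0 k)
  d_homogeneous : ∀ i k, d i (Pi.single k 1) ∈ degreePart K n (shift i) (shift (i + 1) k)
  range_aug : LinearMap.range aug = N
  exact_aug : LinearMap.ker aug = LinearMap.range (d 0)
  exact_d : ∀ i, LinearMap.ker (d i) = LinearMap.range (d (i + 1))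
  /-- Minimality: the image of each differential lies in `(X₁, …, Xₙ) Fᵢ`. -/
  minimal : ∀ i x k, d i x k ∈ idealOfVars (Fin n) K

/-- The graded Betti number `β_{ij}(N)`: the number of basis elements of degree `j` of `Fᵢ` in a
minimal graded free resolution of `N`. It does not depend on the resolution, so that the infimum
is over a one-element set when `N` is graded. -/
def gradedBetti {m : ℕ} (D : Fin m → ℤ)
    (N : Submodule (MvPolynomial (Fin n) K) (Fin m → MvPolynomial (Fin n) K))
    (i : ℕ) (j : ℤ) : ℕ :=
  sInf {b | ∃ P : MinimalGradedFreeResolution D N, Nat.card {k // P.shift i k = j} = b}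

/-- The total Betti number `βᵢ(N)`: the rank of `Fᵢ` in a minimal graded free resolution of `N`. -/
def betti {m : ℕ} (D : Fin m → ℤ)
    (N : Submodule (MvPolynomial (Fin n) K) (Fin m → MvPolynomial (Fin n) K)) (i : ℕ) : ℕ :=
  sInf {b | ∃ P : MinimalGradedFreeResolution D N, P.rank i = b}

/-- The Castelnuovo-Mumford regularity `sup {j - i | β_{ij}(N) ≠ 0}`, which is `-∞` for `N = 0`. -/
def regularity {m : ℕ} (D : Fin m → ℤ)
    (N : Submodule (MvPolynomial (Fin n) K) (Fin m → MvPolynomial (Fin n) K)) : EReal :=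
  ⨆ (i : ℕ) (j : ℤ) (_ : gradedBetti D N i j ≠ 0), (((j - i : ℤ) : ℝ) : EReal)

/-- `M` is `r`-componentwise regular if `reg M_⟨a⟩ ≤ a + r` for all `a`. -/
def IsComponentwiseRegular {m : ℕ} (D : Fin m → ℤ) (r : ℤ)
    (M : Submodule (MvPolynomial (Fin n) K) (Fin m → MvPolynomial (Fin n) K)) : Prop :=
  ∀ a : ℤ, regularity D (generatedInDegree D a M) ≤ (((a + r : ℤ) : ℝ) : EReal)

/-- `M` is componentwise linear if `reg M_⟨a⟩ ≤ a` for all `a`, that is, if every `M_⟨a⟩` is zero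
or has an `a`-linear resolution. -/
def IsComponentwiseLinear {m : ℕ} (D : Fin m → ℤ)
    (M : Submodule (MvPolynomial (Fin n) K) (Fin m → MvPolynomial (Fin n) K)) : Prop :=
  IsComponentwiseRegular D 0 M

end GradedFree

end

noncomputable section

namespace GradedFree

/-! ### Components with respect to an integral weight -/

section Components

variable {K : Type*} [Field K] {n m r : ℕ}

/-! Write in(M) for the initial module and 𝔪 for the ideal of the variables. Passing to initial
forms preserves dimensions in each degree: a basis of a finite-dimensional space can be chosen so
that its initial forms are a basis of the space of initial forms (`exists_basis_initial`,
`finrank_inn`).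

Since β₀ⱼ(M) = dim Mⱼ - dim (𝔪M)ⱼ and 𝔪 in(M) ⊆ in(𝔪M), always β₀ⱼ(M) ≤ β₀ⱼ(in(M)). Equality of the
totals therefore forces equality for every j, and then in(𝔪M) = 𝔪 in(M) in each degree
(`inn_mulVars`).

Next, in(M_⟨a⟩) = in(M)_⟨a⟩ (`initialModule_generatedInDegree`). Let f be a basis of M_a whose
initial forms p are a basis of in(M)_a. By linearity the syzygies of p are generated in degree a +
1. Applying such a syzygy to f gives an element of (𝔪M)_{a+1} of smaller weight than expected.
Initial forms there lie in 𝔪 in(M)_a, hence are combinations of p, so the element can be reduced to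
zero and the syzygy lifts to one of f. As in Buchberger's criterion, lifting of syzygies implies
that p generates in(M_⟨a⟩).

So N = M_⟨a⟩ has an initial module with a-linear resolution, and linearity passes from in(N) to N
(`gradedBetti_eq_zero_of_initialModule_linear`): f minimally generates N, and the syzygies of p are
the initial module of the syzygies of f when the k-th basis vector is weighted by the weight of `p
k`. Induct on the homological index. -/

/-- The free module of rank `m` over `K[X₁, …, Xₙ]`. -/
abbrev FreeMod (K : Type*) [Field K] (n m : ℕ) := Fin m → MvPolynomial (Fin n) K

/-- The component of weight `w` when `X ^ u • eₖ` has weight `ν ⬝ u + E k`. -/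
def hcomp (ν : Fin n → ℤ) (E : Fin m → ℤ) (w : ℤ) : FreeMod K n m →ₗ[K] FreeMod K n m where
  toFun f k := weightedHomogeneousComponent ν (w - E k) (f k)
  map_add' f g := by ext k : 1; simp
  map_smul' c f := by ext k : 1; simp

/-- The linear map `A^r → A^m` sending the `k`-th basis vector to `f k`. -/
abbrev lc (f : Fin r → FreeMod K n m) :
    FreeMod K n r →ₗ[MvPolynomial (Fin n) K] FreeMod K n m :=
  Fintype.linearCombination (MvPolynomial (Fin n) K) f

lemma lc_apply (f : Fin r → FreeMod K n m) (g : FreeMod K n r) : lc f g = ∑ k, g k • f k := rfl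

variable {ν ν' : Fin n → ℤ} {E E' : Fin m → ℤ}

lemma coeff_hcomp (w : ℤ) (f : FreeMod K n m) (k : Fin m) (u : Fin n →₀ ℕ) :
    coeff u (hcomp ν E w f k) = if Finsupp.weight ν u + E k = w then coeff u (f k) else 0 := by
  change coeff u (weightedHomogeneousComponent ν (w - E k) (f k)) = _
  rw [coeff_weightedHomogeneousComponent]
  simp only [eq_sub_iff_add_eq]

lemma ext_coeff {f g : FreeMod K n m} (h : ∀ k u, coeff u (f k) = coeff u (g k)) : f = g :=
  funext fun k => MvPolynomial.ext _ _ (h k)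

lemma hcomp_hcomp (w w' : ℤ) (f : FreeMod K n m) :
    hcomp ν E w (hcomp ν E w' f) = if w' = w then hcomp ν E w f else 0 := by
  refine ext_coeff fun k u => ?_
  split_ifs with h
  · subst h; simp only [coeff_hcomp]; split_ifs <;> rfl
  · simp only [coeff_hcomp, Pi.zero_apply, coeff_zero]
    split_ifs with h1 h2
    · exact absurd (h2.symm.trans h1) h
    all_goals rfl

@[simp] lemma hcomp_idem (w : ℤ) (f : FreeMod K n m) :
    hcomp ν E w (hcomp ν E w f) = hcomp ν E w f := by simp [hcomp_hcomp]

lemma hcomp_of_hom {w w' : ℤ} {f : FreeMod K n m} (hf : hcomp ν E w' f = f) :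
    hcomp ν E w f = if w' = w then f else 0 := by
  rw [← hf, hcomp_hcomp]
  split_ifs with h
  · rw [← h]
  · rfl

/-- Degree (all variables of degree 1, shifts `D`) and weight (`ω`, `ε`) are two instances of the
same kind of grading, both diagonal on monomials. This is why initial forms can be taken one degree
at a time. -/
lemma hcomp_comm (w w' : ℤ) (f : FreeMod K n m) :
    hcomp ν E w (hcomp ν' E' w' f) = hcomp ν' E' w' (hcomp ν E w f) := by
  refine ext_coeff fun k u => ?_
  simp only [coeff_hcomp]
  split_ifs <;> rfl

lemma hcomp_X_smul (w : ℤ) (i : Fin n) (f : FreeMod K n m) :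
    hcomp ν E w ((X i : MvPolynomial (Fin n) K) • f) =
      (X i : MvPolynomial (Fin n) K) • hcomp ν E (w - ν i) f := by
  classical
  refine ext_coeff fun k u => ?_
  simp only [coeff_hcomp, Pi.smul_apply, smul_eq_mul, coeff_X_mul']
  by_cases hi : i ∈ u.support
  · have hu : Finsupp.weight ν u = Finsupp.weight ν (u - Finsupp.single i 1) + ν i := by
      have h1 : u - Finsupp.single i 1 + Finsupp.single i 1 = u := by
        refine tsub_add_cancel_of_le ?_
        rw [Finsupp.single_le_iff]
        exact Nat.one_le_iff_ne_zero.2 (Finsupp.mem_support_iff.1 hi)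
      conv_lhs => rw [← h1]
      simp [Finsupp.weight_single]
    simp only [hi, if_true]
    have : Finsupp.weight ν u + E k = w ↔
        Finsupp.weight ν (u - Finsupp.single i 1) + E k = w - ν i := by omega
    simp only [this]
  · simp [hi]

lemma exists_eq_sum_hcomp (ν : Fin n → ℤ) (E : Fin m → ℤ) (f : FreeMod K n m) :
    ∃ s : Finset ℤ, f = ∑ w ∈ s, hcomp ν E w f := by
  classical
  refine ⟨Finset.univ.biUnion fun k => (f k).support.image fun u => Finsupp.weight ν u + E k,
    ext_coeff fun k u => ?_⟩
  rw [Finset.sum_apply, coeff_sum]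
  simp only [coeff_hcomp]
  rw [Finset.sum_ite_eq]
  by_cases h : coeff u (f k) = 0
  · simp [h]
  · rw [if_pos]
    simp only [Finset.mem_biUnion, Finset.mem_univ, true_and, Finset.mem_image, mem_support_iff]
    exact ⟨k, u, h, rfl⟩

/-- A `K`-subspace containing all components of `f` contains `f`. -/
lemma mem_of_hcomp_mem (ν : Fin n → ℤ) (E : Fin m → ℤ) {W : Submodule K (FreeMod K n m)}
    {f : FreeMod K n m} (h : ∀ w, hcomp ν E w f ∈ W) : f ∈ W := by
  obtain ⟨s, hs⟩ := exists_eq_sum_hcomp ν E f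
  rw [hs]
  exact sum_mem fun w _ => h w

lemma eq_zero_of_hcomp_eq_zero (ν : Fin n → ℤ) (E : Fin m → ℤ) {f : FreeMod K n m}
    (h : ∀ w, hcomp ν E w f = 0) : f = 0 := by
  have := mem_of_hcomp_mem ν E (W := ⊥) (f := f) (fun w => by simp [h w])
  simpa using this

lemma hcomp_smul_of_hom {s : ℤ} {f : FreeMod K n m} (hf : hcomp ν E s f = f) (w : ℤ)
    (c : MvPolynomial (Fin n) K) :
    hcomp ν E w (c • f) = weightedHomogeneousComponent ν (w - s) c • f := by
  induction c using MvPolynomial.induction_on generalizing w with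
  | C a =>
    have h1 : ∀ g : FreeMod K n m, (C a : MvPolynomial (Fin n) K) • g = a • g := fun g => by
      rw [← algebraMap_eq, algebraMap_smul]
    rw [h1, map_smul, hcomp_of_hom hf]
    have h2 := weightedHomogeneousComponent_of_mem (m := w - s) (isWeightedHomogeneous_C ν a)
    rw [h2]
    by_cases h : s = w
    · simp [h, h1]
    · rw [if_neg h, if_neg (by omega)]; simp
  | add p q hp hq => simp only [add_smul, map_add, hp, hq]
  | mul_X p i hp =>
    rw [mul_comm, mul_smul, hcomp_X_smul, hp, ← mul_smul]
    congr 1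
    classical
    ext u
    simp only [coeff_X_mul', coeff_weightedHomogeneousComponent]
    by_cases hi : i ∈ u.support
    · have h1 : u - Finsupp.single i 1 + Finsupp.single i 1 = u := by
        refine tsub_add_cancel_of_le ?_
        rw [Finsupp.single_le_iff]
        exact Nat.one_le_iff_ne_zero.2 (Finsupp.mem_support_iff.1 hi)
      have hu : Finsupp.weight ν u = Finsupp.weight ν (u - Finsupp.single i 1) + ν i := by
        conv_lhs => rw [← h1]
        simp [Finsupp.weight_single]
      have : Finsupp.weight ν u = w - s ↔
        Finsupp.weight ν (u - Finsupp.single i 1) = w - ν i - s := by omega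
      simp only [hi, if_true, this]
    · simp [hi]

/-- A map sending basis vectors to homogeneous elements commutes with taking components. -/
lemma hcomp_lc {s : Fin r → ℤ} {f : Fin r → FreeMod K n m}
    (hf : ∀ k, hcomp ν E (s k) (f k) = f k) (w : ℤ) (g : FreeMod K n r) :
    hcomp ν E w (lc f g) = lc f (hcomp ν s w g) := by
  simp only [lc_apply, map_sum]
  exact Finset.sum_congr rfl fun k _ => hcomp_smul_of_hom (hf k) w (g k)

lemma mem_degreePart {D : Fin m → ℤ} {j : ℤ} {f : FreeMod K n m} :
    f ∈ degreePart K n D j ↔ hcomp (fun _ => 1) D j f = f := by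
  simp only [degreePart, Submodule.mem_pi, Set.mem_univ, true_implies,
    mem_weightedHomogeneousSubmodule]
  constructor
  · intro h
    exact funext fun k => (h k).weightedHomogeneousComponent_same
  · intro h k
    rw [← h]
    exact weightedHomogeneousComponent_isWeightedHomogeneous _ _

lemma degreeComponent_eq (D : Fin m → ℤ) (j : ℤ) (f : FreeMod K n m) :
    degreeComponent D j f = hcomp (fun _ => 1) D j f := rfl

/-- Only finitely many monomials have a given degree; all dimension counts below rest on this. -/
instance finiteDimensional_degreePart (D : Fin m → ℤ) (j : ℤ) :
    FiniteDimensional K (degreePart K n D j) := by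
  have hfg : ∀ d : ℤ, (weightedHomogeneousSubmodule K (fun _ : Fin n => (1 : ℤ)) d).FG := by
    intro d
    rw [weightedHomogeneousSubmodule_eq_finsupp_supported, ← Module.Finite.iff_fg]
    have hfin : {u : Fin n →₀ ℕ | Finsupp.weight (fun _ : Fin n => (1 : ℤ)) u = d}.Finite := by
      refine (Finsupp.finite_of_degree_le d.toNat).subset fun u hu => ?_
      have h1 : Finsupp.weight (fun _ : Fin n => (1 : ℤ)) u = (u.degree : ℤ) := by
        simp [Finsupp.weight_apply, Finsupp.degree_apply, Finsupp.sum]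
      simp only [Set.mem_ofPred_eq] at hu ⊢
      omega
    have := hfin.to_subtype
    exact Module.Finite.of_basis (basisRestrictSupport K _)
  exact Module.Finite.iff_fg.2 (Submodule.fg_pi fun k => hfg _)

end Components

/-! ### Initial forms -/

section InitialForms

variable {K : Type*} [Field K] {n m r : ℕ}

/-- The elements all of whose terms have weight less than `w`. -/
def wlt (ν : Fin n → ℤ) (E : Fin m → ℤ) (w : ℤ) : Submodule K (FreeMod K n m) where
  carrier := {f | ∀ k u, w ≤ Finsupp.weight ν u + E k → coeff u (f k) = 0}
  add_mem' hf hg k u h := by simp [hf k u h, hg k u h]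
  zero_mem' k u _ := by simp
  smul_mem' c f hf k u h := by simp [hf k u h]

/-- The space of sums of initial forms of elements of `W`. -/
def inn (ν : Fin n → ℤ) (E : Fin m → ℤ) (W : Submodule K (FreeMod K n m)) :
    Submodule K (FreeMod K n m) where
  -- The bound `w + 1` allows terms of weight up to `w`. The component of `y` in weight `w` may
  -- vanish, which makes the set closed under addition.
  carrier := {x | ∀ w, ∃ y ∈ W, y ∈ wlt ν E (w + 1) ∧ hcomp ν E w y = hcomp ν E w x}
  add_mem' {a b} ha hb w := by
    obtain ⟨y, h1, h2, h3⟩ := ha w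
    obtain ⟨z, k1, k2, k3⟩ := hb w
    exact ⟨y + z, add_mem h1 k1, add_mem h2 k2, by rw [map_add, map_add, h3, k3]⟩
  zero_mem' w := ⟨0, zero_mem _, zero_mem _, rfl⟩
  smul_mem' c x hx w := by
    obtain ⟨y, h1, h2, h3⟩ := hx w
    exact ⟨c • y, W.smul_mem _ h1, Submodule.smul_mem _ _ h2, by rw [map_smul, map_smul, h3]⟩

variable {ν ν' : Fin n → ℤ} {E E' : Fin m → ℤ}

lemma wlt_mono {w w' : ℤ} (h : w ≤ w') :
    (wlt ν E w : Submodule K (FreeMod K n m)) ≤ wlt ν E w' :=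
  fun _ hf k u hu => hf k u (h.trans hu)

lemma hcomp_eq_zero_of_mem_wlt {w v : ℤ} {f : FreeMod K n m} (hf : f ∈ wlt ν E w) (h : w ≤ v) :
    hcomp ν E v f = 0 := by
  refine ext_coeff fun k u => ?_
  rw [coeff_hcomp]
  split_ifs with hu
  · exact hf k u (by omega)
  · rfl

lemma mem_wlt_of_hcomp_eq_zero {w : ℤ} {f : FreeMod K n m} (hf : f ∈ wlt ν E (w + 1))
    (h : hcomp ν E w f = 0) : f ∈ wlt ν E w := by
  intro k u hu
  rcases hu.eq_or_lt with hu | hu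
  · have := congrArg (fun g : FreeMod K n m => coeff u (g k)) h
    simpa [coeff_hcomp, hu.symm] using this
  · exact hf k u hu

lemma hcomp_mem_wlt (w : ℤ) (f : FreeMod K n m) : hcomp ν E w f ∈ wlt ν E (w + 1) := by
  intro k u hu
  rw [coeff_hcomp, if_neg (by omega)]

lemma hcomp_mem_wlt_of_mem {w j : ℤ} {f : FreeMod K n m} (hf : f ∈ wlt ν E w) :
    hcomp ν' E' j f ∈ wlt ν E w := by
  intro k u hu
  rw [coeff_hcomp, hf k u hu, ite_self]

lemma sub_hcomp_mem_wlt {w : ℤ} {f : FreeMod K n m} (hf : f ∈ wlt ν E (w + 1)) :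
    f - hcomp ν E w f ∈ wlt ν E w :=
  mem_wlt_of_hcomp_eq_zero (sub_mem hf (hcomp_mem_wlt _ _)) (by simp)

lemma X_smul_mem_wlt {w : ℤ} {f : FreeMod K n m} (i : Fin n) (hf : f ∈ wlt ν E (w - ν i)) :
    (X i : MvPolynomial (Fin n) K) • f ∈ wlt ν E w := by
  classical
  intro k u hu
  simp only [Pi.smul_apply, smul_eq_mul, coeff_X_mul']
  split_ifs with hi
  · refine hf k _ ?_
    have h1 : u - Finsupp.single i 1 + Finsupp.single i 1 = u := by
      refine tsub_add_cancel_of_le ?_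
      rw [Finsupp.single_le_iff]
      exact Nat.one_le_iff_ne_zero.2 (Finsupp.mem_support_iff.1 hi)
    rw [← h1, map_add, Finsupp.weight_single] at hu
    simp only [one_smul] at hu
    omega
  · rfl

lemma exists_mem_wlt (ν : Fin n → ℤ) (E : Fin m → ℤ) (f : FreeMod K n m) :
    ∃ w : ℕ, f ∈ wlt ν E w := by
  classical
  obtain ⟨B, hB⟩ := (Finset.univ.biUnion fun k =>
    (f k).support.image fun u => Finsupp.weight ν u + E k).exists_le
  refine ⟨(B + 1).toNat, fun k u hu => ?_⟩
  by_contra h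
  have := hB (Finsupp.weight ν u + E k) (by
    simp only [Finset.mem_biUnion, Finset.mem_univ, true_and, Finset.mem_image, mem_support_iff]
    exact ⟨k, u, h, rfl⟩)
  omega

lemma weight_nonneg (hν : ∀ i, 0 ≤ ν i) (u : Fin n →₀ ℕ) : 0 ≤ Finsupp.weight ν u := by
  rw [Finsupp.weight_apply]
  exact Finset.sum_nonneg fun i _ => nsmul_nonneg (hν i) _

/-- Nonnegative weights make the weight filtration start at 0: this is the base case of every
reduction by descending weight. -/
lemma eq_zero_of_mem_wlt (hν : ∀ i, 0 ≤ ν i) (hE : ∀ k, 0 ≤ E k) {w : ℤ} (hw : w ≤ 0)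
    {f : FreeMod K n m} (hf : f ∈ wlt ν E w) : f = 0 :=
  ext_coeff fun k u => by
    rw [hf k u (by have := weight_nonneg hν u; have := hE k; omega)]; rfl

lemma inn_mono {W W' : Submodule K (FreeMod K n m)} (h : W ≤ W') : inn ν E W ≤ inn ν E W' := by
  intro x hx w
  obtain ⟨y, h1, h2⟩ := hx w
  exact ⟨y, h h1, h2⟩

lemma hcomp_mem_inn {W : Submodule K (FreeMod K n m)} {w : ℤ} {y : FreeMod K n m}
    (hy : y ∈ W) (h : y ∈ wlt ν E (w + 1)) : hcomp ν E w y ∈ inn ν E W := by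
  intro v
  by_cases hv : w = v
  · subst hv; exact ⟨y, hy, h, by simp⟩
  · exact ⟨0, zero_mem _, zero_mem _, by simp [hcomp_hcomp, hv]⟩

/-- Two spaces are allowed so that it applies both to a submodule (`W = W'`) and to the passage from
M_{j-1} to (𝔪M)_j. -/
lemma X_smul_mem_inn {W W' : Submodule K (FreeMod K n m)} (i : Fin n)
    (hW : ∀ y ∈ W, (X i : MvPolynomial (Fin n) K) • y ∈ W') {x : FreeMod K n m}
    (hx : x ∈ inn ν E W) : (X i : MvPolynomial (Fin n) K) • x ∈ inn ν E W' := by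
  intro w
  obtain ⟨y, h1, h2, h3⟩ := hx (w - ν i)
  refine ⟨(X i : MvPolynomial (Fin n) K) • y, hW y h1, X_smul_mem_wlt i ?_, ?_⟩
  · rwa [show w + 1 - ν i = w - ν i + 1 by ring]
  · rw [hcomp_X_smul, hcomp_X_smul, h3]

/-! ### Comparison with the initial module -/

lemma weight_natCast (ω : Fin n → ℕ) (u : Fin n →₀ ℕ) :
    Finsupp.weight (fun i => (ω i : ℤ)) u = (Finsupp.weight ω u : ℤ) := by
  simp [Finsupp.weight_apply, Finsupp.sum]

lemma initialPart_eq (ω : Fin n → ℕ) (ε : Fin m → ℕ) (f : FreeMod K n m) :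
    initialPart ω ε f = hcomp (fun i => (ω i : ℤ)) (fun k => (ε k : ℤ)) (maxWeight ω ε f) f := by
  classical
  refine ext_coeff fun k u => ?_
  rw [coeff_hcomp, weight_natCast, initialPart, coeff_sum]
  simp only [coeff_monomial, Finset.sum_ite_eq', Finset.mem_filter, mem_support_iff]
  norm_cast
  split_ifs with h1 h2 h3
  · rfl
  · exact absurd h1.2 h2
  · by_contra h
    exact h1 ⟨fun h' => h h'.symm, h3⟩
  · rfl

lemma le_maxWeight (ω : Fin n → ℕ) (ε : Fin m → ℕ) (f : FreeMod K n m) {k : Fin m}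
    {u : Fin n →₀ ℕ} (h : coeff u (f k) ≠ 0) : Finsupp.weight ω u + ε k ≤ maxWeight ω ε f :=
  (Finset.le_sup (f := fun u => Finsupp.weight ω u + ε k) (mem_support_iff.2 h)).trans
    (Finset.le_sup (f := fun k => (f k).support.sup fun u => Finsupp.weight ω u + ε k)
      (Finset.mem_univ k))

lemma mem_wlt_maxWeight (ω : Fin n → ℕ) (ε : Fin m → ℕ) (f : FreeMod K n m) :
    f ∈ wlt (fun i => (ω i : ℤ)) (fun k => (ε k : ℤ)) ((maxWeight ω ε f : ℤ) + 1) := by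
  intro k u hu
  by_contra h
  have := le_maxWeight ω ε f h
  rw [weight_natCast] at hu
  simp only at hu
  omega

lemma initialPart_eq_of_hcomp_ne_zero (ω : Fin n → ℕ) (ε : Fin m → ℕ) {f : FreeMod K n m} {w : ℤ}
    (hf : f ∈ wlt (fun i => (ω i : ℤ)) (fun k => (ε k : ℤ)) (w + 1))
    (h0 : hcomp (fun i => (ω i : ℤ)) (fun k => (ε k : ℤ)) w f ≠ 0) :
    initialPart ω ε f = hcomp (fun i => (ω i : ℤ)) (fun k => (ε k : ℤ)) w f := by
  rw [initialPart_eq]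
  have h1 : w ≤ maxWeight ω ε f := by
    by_contra h
    exact h0 (hcomp_eq_zero_of_mem_wlt (mem_wlt_maxWeight ω ε f) (by omega))
  have h2 : (maxWeight ω ε f : ℤ) ≤ w := by
    by_contra h
    have hz := hcomp_eq_zero_of_mem_wlt hf (v := maxWeight ω ε f) (by omega)
    have hall : ∀ k u, coeff u (f k) ≠ 0 → Finsupp.weight ω u + ε k < maxWeight ω ε f := by
      intro k u hu
      refine lt_of_le_of_ne (le_maxWeight ω ε f hu) fun he => hu ?_
      have := congrArg (fun g : FreeMod K n m => coeff u (g k)) hz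
      simp only [coeff_hcomp, weight_natCast, Pi.zero_apply, coeff_zero] at this
      rwa [if_pos (by exact_mod_cast he)] at this
    -- A finite supremum is strictly below a bound only if the bound exceeds the default value `⊥ =
    -- 0`; a zero bound would leave no terms in `f`.
    have hpos : ⊥ < maxWeight ω ε f := by
      rw [Nat.bot_eq_zero]
      rcases Nat.eq_zero_or_pos (maxWeight ω ε f) with h' | h'
      · exfalso
        refine h0 ?_
        have : f = 0 := ext_coeff fun k u => by
          by_contra hu
          have := hall k u hu
          omega
        rw [this, map_zero]
      · exact h'
    have : maxWeight ω ε f < maxWeight ω ε f := by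
      conv_lhs => rw [maxWeight]
      rw [Finset.sup_lt_iff hpos]
      intro k _
      rw [Finset.sup_lt_iff hpos]
      exact fun u hu => hall k u (mem_support_iff.1 hu)
    exact lt_irrefl _ this
  rw [le_antisymm h2 h1]

lemma mem_initialModule {ω : Fin n → ℕ} {ε : Fin m → ℕ}
    {N : Submodule (MvPolynomial (Fin n) K) (FreeMod K n m)} {x : FreeMod K n m} :
    x ∈ initialModule ω ε N ↔
      x ∈ inn (fun i => (ω i : ℤ)) (fun k => (ε k : ℤ)) (N.restrictScalars K) := by
  constructor
  · intro hx
    induction hx using Submodule.span_induction with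
    | mem x hx =>
      obtain ⟨y, hy, rfl⟩ := hx
      rw [initialPart_eq]
      exact hcomp_mem_inn hy (mem_wlt_maxWeight ω ε y)
    | zero => exact zero_mem _
    | add x y _ _ hx hy => exact add_mem hx hy
    | smul c x _ hx =>
      induction c using MvPolynomial.induction_on generalizing x with
      | C a =>
        rw [← algebraMap_eq, algebraMap_smul]
        exact Submodule.smul_mem _ _ hx
      | add p q hp hq =>
        rw [add_smul]
        exact add_mem (hp x ‹_› hx) (hq x ‹_› hx)
      | mul_X p i hp =>
        rw [mul_comm, mul_smul]
        exact X_smul_mem_inn i (fun y hy => N.smul_mem _ hy) (hp x ‹_› hx)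
  · intro hx
    change x ∈ (initialModule ω ε N).restrictScalars K
    refine mem_of_hcomp_mem (fun i => (ω i : ℤ)) (fun k => (ε k : ℤ)) fun w => ?_
    obtain ⟨y, h1, h2, h3⟩ := hx w
    rw [← h3]
    by_cases h0 : hcomp (fun i => (ω i : ℤ)) (fun k => (ε k : ℤ)) w y = 0
    · rw [h0]; exact zero_mem _
    · rw [← initialPart_eq_of_hcomp_ne_zero ω ε h2 h0]
      exact Submodule.subset_span ⟨y, h1, rfl⟩

lemma inn_le_initialModule {ω : Fin n → ℕ} {ε : Fin m → ℕ}
    {N : Submodule (MvPolynomial (Fin n) K) (FreeMod K n m)} {W : Submodule K (FreeMod K n m)}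
    (hW : ∀ y ∈ W, y ∈ N) {x : FreeMod K n m}
    (hx : x ∈ inn (fun i => (ω i : ℤ)) (fun k => (ε k : ℤ)) W) : x ∈ initialModule ω ε N :=
  mem_initialModule.2 (inn_mono (W' := N.restrictScalars K) hW hx)

/-! ### Bases with prescribed initial forms -/

/-- In a relation among the `f`, the component in the largest weight `e i₀` carrying a nonzero
coefficient is a relation among those `p i` with `e i = e i₀`. -/
lemma linearIndependent_of_hcomp {ι : Type*} {f p : ι → FreeMod K n m} {e : ι → ℤ}
    (hf : ∀ k, f k ∈ wlt ν E (e k + 1)) (hp : ∀ k, hcomp ν E (e k) (f k) = p k)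
    (h : LinearIndependent K p) : LinearIndependent K f := by
  classical
  rw [linearIndependent_iff'] at h ⊢
  intro s c hc
  by_contra! hne
  obtain ⟨i, his, hi⟩ := hne
  obtain ⟨i₀, hi₀, hmax⟩ := (s.filter fun i => c i ≠ 0).exists_max_image e ⟨i, by simp [his, hi]⟩
  rw [Finset.mem_filter] at hi₀
  have h1 := h (s.filter fun i => e i = e i₀) c (by
    have h0 := congrArg (hcomp ν E (e i₀)) hc
    rw [map_sum, map_zero] at h0
    rw [Finset.sum_filter]
    refine Eq.trans ?_ h0
    refine Finset.sum_congr rfl fun k hk => ?_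
    rw [map_smul]
    split_ifs with hk0
    · rw [← hk0, hp]
    · by_cases hck : c k = 0
      · simp [hck]
      · have := hmax k (by simp [hk, hck])
        rw [hcomp_eq_zero_of_mem_wlt (hf k) (by omega), smul_zero]) i₀ (by simp [hi₀.1])
  exact hi₀.2 h1

/-- A finite-dimensional space has a basis whose initial forms are a basis of the space of
initial forms. -/
lemma exists_basis_initial (hν : ∀ i, 0 ≤ ν i) (hE : ∀ k, 0 ≤ E k)
    (W : Submodule K (FreeMod K n m)) [FiniteDimensional K W] :
    ∃ (r : ℕ) (f p : Fin r → FreeMod K n m) (e : Fin r → ℕ),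
      (∀ k, f k ∈ wlt ν E (e k + 1)) ∧ (∀ k, hcomp ν E (e k) (f k) = p k) ∧
      LinearIndependent K f ∧ LinearIndependent K p ∧
      Submodule.span K (Set.range f) = W ∧ Submodule.span K (Set.range p) = inn ν E W := by
  classical
  set T : Set (FreeMod K n m) :=
    {x | ∃ w : ℕ, ∃ y ∈ W, y ∈ wlt ν E ((w : ℤ) + 1) ∧ hcomp ν E w y = x} with hT
  have hspanT : Submodule.span K T = inn ν E W := by
    refine le_antisymm (Submodule.span_le.2 ?_) fun x hx => mem_of_hcomp_mem ν E fun w => ?_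
    · rintro x ⟨w, y, h1, h2, rfl⟩
      exact hcomp_mem_inn h1 h2
    · obtain ⟨y, h1, h2, h3⟩ := hx w
      rw [← h3]
      by_cases hw : 0 ≤ w
      · lift w to ℕ using hw
        exact Submodule.subset_span ⟨w, y, h1, h2, rfl⟩
      · rw [eq_zero_of_mem_wlt hν hE (by omega) h2, map_zero]
        exact zero_mem _
  -- Extracting the basis from the leading components themselves gives each basis vector a preimage
  -- in `W`.
  obtain ⟨b, hbT, hbspan, hbind⟩ := exists_linearIndependent K T
  have hb : ∀ x : b, ∃ w : ℕ, ∃ y ∈ W, y ∈ wlt ν E ((w : ℤ) + 1) ∧ hcomp ν E w y = x :=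
    fun x => hbT x.2
  choose e y hyW hywlt hyp using hb
  have hyind : LinearIndependent K y :=
    linearIndependent_of_hcomp (e := fun x => (e x : ℤ)) hywlt hyp hbind
  have hyind' : LinearIndependent K (fun x : b => (⟨y x, hyW x⟩ : W)) :=
    LinearIndependent.of_comp W.subtype hyind
  have : Finite b := hyind'.finite
  obtain ⟨r, ⟨σ⟩⟩ := Finite.exists_equiv_fin b
  have hrange : Set.range (fun k => ((σ.symm k : b) : FreeMod K n m)) = b := by
    rw [show (fun k => ((σ.symm k : b) : FreeMod K n m)) = Subtype.val ∘ σ.symm from rfl,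
      Set.range_comp, σ.symm.surjective.range_eq, Set.image_univ, Subtype.range_coe]
  have hpspan : Submodule.span K (Set.range (fun k => ((σ.symm k : b) : FreeMod K n m))) =
      inn ν E W := by rw [hrange, hbspan, hspanT]
  refine ⟨r, fun k => y (σ.symm k), fun k => (σ.symm k : b), fun k => e (σ.symm k),
    fun k => hywlt _, fun k => hyp _, hyind.comp _ σ.symm.injective,
    hbind.comp _ σ.symm.injective, le_antisymm ?_ ?_, hpspan⟩
  · rw [Submodule.span_le]
    rintro _ ⟨k, rfl⟩
    exact hyW _
  · have key : ∀ w : ℕ, ∀ z ∈ W, z ∈ wlt ν E w →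
        z ∈ Submodule.span K (Set.range fun k => y (σ.symm k)) := by
      intro w
      induction w with
      | zero =>
        intro z _ hz
        rw [eq_zero_of_mem_wlt hν hE (by simp) hz]
        exact zero_mem _
      | succ w ih =>
        intro z hzW hz
        push_cast at hz
        have h1 := hcomp_mem_inn hzW hz
        rw [← hpspan, Submodule.mem_span_range_iff_exists_fun] at h1
        obtain ⟨c, hc⟩ := h1
        -- Only basis elements of top weight exactly `w` are used: they alone contribute to the
        -- weight `w` component of `z`, and the others could have larger terms.
        set z' := ∑ k, if (e (σ.symm k) : ℤ) = w then c k • y (σ.symm k) else 0 with hz'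
        have hz's : z' ∈ Submodule.span K (Set.range fun k => y (σ.symm k)) := by
          refine sum_mem fun k _ => ?_
          split_ifs
          · exact Submodule.smul_mem _ _ (Submodule.subset_span ⟨k, rfl⟩)
          · exact zero_mem _
        have hz'W : z' ∈ W := by
          refine sum_mem fun k _ => ?_
          split_ifs
          · exact Submodule.smul_mem _ _ (hyW _)
          · exact zero_mem _
        have hz'w : z' ∈ wlt ν E ((w : ℤ) + 1) := by
          refine sum_mem fun k _ => ?_
          split_ifs with h
          · exact Submodule.smul_mem _ _ (h ▸ hywlt _)
          · exact zero_mem _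
        have hz'h : hcomp ν E w z' = hcomp ν E w z := by
          rw [← hcomp_idem (w : ℤ) z, ← hc, hz', map_sum, map_sum]
          refine Finset.sum_congr rfl fun k _ => ?_
          rw [map_smul, ← hyp, hcomp_hcomp]
          split_ifs <;> simp
        have := ih (z - z') (sub_mem hzW hz'W)
          (mem_wlt_of_hcomp_eq_zero (sub_mem hz hz'w) (by rw [map_sub, hz'h, sub_self]))
        simpa using add_mem this hz's
    intro z hz
    obtain ⟨w, hw⟩ := exists_mem_wlt ν E z
    exact key w z hz hw

lemma finiteDimensional_inn (hν : ∀ i, 0 ≤ ν i) (hE : ∀ k, 0 ≤ E k)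
    (W : Submodule K (FreeMod K n m)) [FiniteDimensional K W] :
    FiniteDimensional K (inn ν E W) := by
  obtain ⟨r, f, p, e, -, -, -, -, -, h⟩ := exists_basis_initial hν hE W
  rw [← h]
  exact FiniteDimensional.span_of_finite K (Set.finite_range p)

lemma finrank_inn (hν : ∀ i, 0 ≤ ν i) (hE : ∀ k, 0 ≤ E k)
    (W : Submodule K (FreeMod K n m)) [FiniteDimensional K W] :
    Module.finrank K (inn ν E W) = Module.finrank K W := by
  obtain ⟨r, f, p, e, -, -, hf, hp, hfs, hps⟩ := exists_basis_initial hν hE W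
  rw [← hps, finrank_span_eq_card hp]
  conv_rhs => rw [← hfs, finrank_span_eq_card hf]

/-! ### Lifting syzygies of initial forms -/

lemma smul_mem_wlt {v t w : ℤ} {c : MvPolynomial (Fin n) K} {q : FreeMod K n m}
    (hc : ∀ u, v < Finsupp.weight ν u → coeff u c = 0) (hq : q ∈ wlt ν E t) (hw : v + t ≤ w) :
    c • q ∈ wlt ν E w := by
  classical
  intro k u hu
  rw [Pi.smul_apply, smul_eq_mul, coeff_mul]
  refine Finset.sum_eq_zero fun x hx => ?_
  rw [Finset.HasAntidiagonal.mem_antidiagonal] at hx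
  rw [← hx, map_add] at hu
  by_cases h : v < Finsupp.weight ν x.1
  · rw [hc _ h, zero_mul]
  · rw [hq k x.2 (by omega), mul_zero]

/-- Used with `t = 1` for the `f` themselves and with `t = 0` for their tails `f k - p k`. -/
lemma lc_mem_wlt {f : Fin r → FreeMod K n m} {e : Fin r → ℤ} {t w : ℤ}
    (hf : ∀ k, f k ∈ wlt ν E (e k + t)) {g : FreeMod K n r} (hg : g ∈ wlt ν e (w + 1)) :
    lc f g ∈ wlt ν E (w + t) := by
  rw [lc_apply]
  refine sum_mem fun k _ => smul_mem_wlt (v := w - e k) (fun u hu => hg k u (by omega)) (hf k) ?_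
  omega

variable {f p : Fin r → FreeMod K n m} {e : Fin r → ℤ}

/-- Replacing each `f k` by its leading component `p k` changes the combination only in weights
below `w`. -/
lemma hcomp_lc_top (hf : ∀ k, f k ∈ wlt ν E (e k + 1)) (hp : ∀ k, hcomp ν E (e k) (f k) = p k)
    {w : ℤ} {g : FreeMod K n r} (hg : g ∈ wlt ν e (w + 1)) :
    hcomp ν E w (lc f g) = lc p (hcomp ν e w g) := by
  have h1 : lc f g = lc p g + lc (fun k => f k - p k) g := by
    simp only [lc_apply, smul_sub, Finset.sum_sub_distrib]
    abel
  have h2 : lc (fun k => f k - p k) g ∈ wlt ν E (w + 0) := by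
    refine lc_mem_wlt (fun k => ?_) hg
    rw [← hp, add_zero]
    exact sub_hcomp_mem_wlt (hf k)
  rw [h1, map_add, hcomp_eq_zero_of_mem_wlt h2 (by simp), add_zero]
  exact hcomp_lc (fun k => by rw [← hp, hcomp_idem]) w g

/-- Standard representations: if the initial form of each `h ∈ W` is a combination of the
initial forms `p`, in a way that stays in `W`, then `h` is a combination of the `f` with
coefficients of no larger weight. -/
lemma exists_standard_repr (hν : ∀ i, 0 ≤ ν i) (hE : ∀ k, 0 ≤ E k)
    (hf : ∀ k, f k ∈ wlt ν E (e k + 1)) (hp : ∀ k, hcomp ν E (e k) (f k) = p k)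
    {W : Submodule K (FreeMod K n m)}
    (hW : ∀ w, ∀ h ∈ W, h ∈ wlt ν E (w + 1) → ∃ c : FreeMod K n r,
      lc p c = hcomp ν E w h ∧ hcomp ν e w c = c ∧ lc f c ∈ W)
    (w : ℤ) {h : FreeMod K n m} (hh : h ∈ W) (hw : h ∈ wlt ν E w) :
    ∃ g ∈ wlt ν e w, lc f g = h := by
  have key : ∀ w : ℕ, ∀ h ∈ W, h ∈ wlt ν E (w : ℤ) → ∃ g ∈ wlt ν e (w : ℤ), lc f g = h := by
    intro w
    induction w with
    | zero =>
      intro h _ hw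
      refine ⟨0, zero_mem _, ?_⟩
      rw [eq_zero_of_mem_wlt hν hE (by simp) hw, map_zero]
    | succ w ih =>
      intro h hh hw
      push_cast at hw ⊢
      -- Subtracting `lc f c` cancels the leading component and stays in `W`, so the weight bound
      -- drops by one.
      obtain ⟨c, h1, h2, h3⟩ := hW w h hh hw
      have hcw : c ∈ wlt ν e ((w : ℤ) + 1) := h2 ▸ hcomp_mem_wlt _ _
      obtain ⟨g, hg, hgh⟩ := ih (h - lc f c) (sub_mem hh h3)
        (mem_wlt_of_hcomp_eq_zero (sub_mem hw (lc_mem_wlt hf hcw))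
          (by rw [map_sub, hcomp_lc_top hf hp hcw, h2, h1, sub_self]))
      exact ⟨g + c, add_mem (wlt_mono (by omega) hg) hcw, by rw [map_add, hgh, sub_add_cancel]⟩
  by_cases h0 : 0 ≤ w
  · lift w to ℕ using h0
    exact key w h hh hw
  · refine ⟨0, zero_mem _, ?_⟩
    rw [eq_zero_of_mem_wlt hν hE (by omega) hw, map_zero]

/-- If every syzygy of the initial forms lifts, then the initial forms generate. -/
lemma hcomp_mem_range_of_syzygies_lift (hν : ∀ i, 0 ≤ ν i) (he : ∀ k, 0 ≤ e k)
    (hf : ∀ k, f k ∈ wlt ν E (e k + 1)) (hp : ∀ k, hcomp ν E (e k) (f k) = p k)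
    (hsyz : ∀ s, lc p s = 0 → s ∈ inn ν e ((LinearMap.ker (lc f)).restrictScalars K))
    (v : ℤ) (g : FreeMod K n r) (hv : lc f g ∈ wlt ν E (v + 1)) :
    hcomp ν E v (lc f g) ∈ LinearMap.range (lc p) := by
  obtain ⟨w, hw⟩ := exists_mem_wlt ν e g
  induction w generalizing g with
  | zero =>
    rw [eq_zero_of_mem_wlt hν he (by simp) hw, map_zero, map_zero]
    exact zero_mem _
  | succ w ih =>
    push_cast at hw
    rcases lt_trichotomy v (w : ℤ) with h | h | h
    · have h1 : lc p (hcomp ν e w g) = 0 := by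
        rw [← hcomp_lc_top hf hp hw]
        exact hcomp_eq_zero_of_mem_wlt hv h
      obtain ⟨y, hy1, hy2, hy3⟩ := hsyz _ h1 w
      rw [hcomp_idem] at hy3
      have hy0 : lc f y = 0 := hy1
      have h2 : lc f (g - y) = lc f g := by rw [map_sub, hy0, sub_zero]
      rw [← h2]
      exact ih (g - y) (by rwa [h2])
        (mem_wlt_of_hcomp_eq_zero (sub_mem hw hy2) (by rw [map_sub, hy3, sub_self]))
    · subst h
      rw [hcomp_lc_top hf hp hw]
      exact ⟨_, rfl⟩
    · rw [hcomp_eq_zero_of_mem_wlt (lc_mem_wlt hf hw) h]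
      exact zero_mem _

end InitialForms

/-! ### Minimal covers -/

section MinimalCovers

variable {K : Type*} [Field K] {n m r r' : ℕ}

lemma mem_idealOfVars_iff {p : MvPolynomial (Fin n) K} :
    p ∈ idealOfVars (Fin n) K ↔ coeff 0 p = 0 := by
  have := mem_pow_idealOfVars_iff' (σ := Fin n) (R := K) 1 p
  rw [pow_one] at this
  rw [this]
  constructor
  · exact fun h => h 0 (by simp)
  · intro h x hx
    have : x = 0 := by
      rw [← Finsupp.degree_eq_zero_iff]
      omega
    rw [this, h]

/-- A vector with entries in the irrelevant ideal is a combination of the variables. -/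
lemma exists_eq_sum_X_smul {g : FreeMod K n r} (hg : ∀ k, g k ∈ idealOfVars (Fin n) K) :
    ∃ h : Fin n → FreeMod K n r, g = ∑ i, (X i : MvPolynomial (Fin n) K) • h i := by
  have : ∀ k, ∃ q : Fin n → MvPolynomial (Fin n) K, ∑ i, q i * X i = g k := fun k => by
    have := hg k
    rw [idealOfVars, Ideal.mem_span_range_iff_exists_fun] at this
    exact this
  choose q hq using this
  refine ⟨fun i k => q k i, funext fun k => ?_⟩
  rw [Finset.sum_apply, ← hq]
  exact Finset.sum_congr rfl fun i _ => mul_comm _ _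

/-- Homogeneous generators `f` of `N`, of degrees `s`, with all relations in `(X₁, …, Xₙ)`. -/
structure IsMinCover (D : Fin m → ℤ) (N : Submodule (MvPolynomial (Fin n) K) (FreeMod K n m))
    (s : Fin r → ℤ) (f : Fin r → FreeMod K n m) : Prop where
  hom : ∀ k, hcomp (fun _ => 1) D (s k) (f k) = f k
  range : LinearMap.range (lc f) = N
  min : ∀ g, lc f g = 0 → ∀ k, g k ∈ idealOfVars (Fin n) K

/-- The degree `j` component of a submodule. -/
def gpart (D : Fin m → ℤ) (N : Submodule (MvPolynomial (Fin n) K) (FreeMod K n m)) (j : ℤ) :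
    Submodule K (FreeMod K n m) := N.restrictScalars K ⊓ degreePart K n D j

/-- The degree `j` component of `(X₁, …, Xₙ) N`. -/
def mulVars (D : Fin m → ℤ) (N : Submodule (MvPolynomial (Fin n) K) (FreeMod K n m)) (j : ℤ) :
    Submodule K (FreeMod K n m) :=
  Submodule.span K
    {z | ∃ i : Fin n, ∃ y ∈ gpart D N (j - 1), z = (X i : MvPolynomial (Fin n) K) • y}

variable {D : Fin m → ℤ} {N : Submodule (MvPolynomial (Fin n) K) (FreeMod K n m)}
  {s : Fin r → ℤ} {f : Fin r → FreeMod K n m} {s' : Fin r' → ℤ} {f' : Fin r' → FreeMod K n m}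

lemma mem_gpart {j : ℤ} {x : FreeMod K n m} :
    x ∈ gpart D N j ↔ x ∈ N ∧ hcomp (fun _ => 1) D j x = x := by
  rw [gpart, Submodule.mem_inf, Submodule.restrictScalars_mem, mem_degreePart]

instance (j : ℤ) : FiniteDimensional K (gpart D N j) :=
  Submodule.finiteDimensional_of_le (inf_le_right : gpart D N j ≤ degreePart K n D j)

lemma mulVars_le_gpart (j : ℤ) : mulVars D N j ≤ gpart D N j := by
  refine Submodule.span_le.2 ?_
  rintro _ ⟨i, y, hy, rfl⟩
  obtain ⟨h1, h2⟩ := mem_gpart.1 hy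
  exact mem_gpart.2 ⟨N.smul_mem _ h1, by rw [hcomp_X_smul, h2]⟩

instance (j : ℤ) : FiniteDimensional K (mulVars D N j) :=
  Submodule.finiteDimensional_of_le (mulVars_le_gpart j)

lemma hcomp_mem_gpart (hN : IsGraded D N) {x : FreeMod K n m} (hx : x ∈ N) (j : ℤ) :
    hcomp (fun _ => 1) D j x ∈ gpart D N j :=
  mem_gpart.2 ⟨hN x hx j, hcomp_idem _ _⟩

lemma lc_mem (hf : ∀ k, f k ∈ N) (g : FreeMod K n r) : lc f g ∈ N := by
  rw [lc_apply]
  exact sum_mem fun k _ => N.smul_mem _ (hf k)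

lemma lc_mem_mulVars (hN : IsGraded D N) (hf : ∀ k, f k ∈ N) {j : ℤ} {g : FreeMod K n r}
    (hg : ∀ k, g k ∈ idealOfVars (Fin n) K) (hj : hcomp (fun _ => 1) D j (lc f g) = lc f g) :
    lc f g ∈ mulVars D N j := by
  obtain ⟨h, rfl⟩ := exists_eq_sum_X_smul hg
  rw [← hj]
  simp only [map_sum, map_smul, hcomp_X_smul]
  exact sum_mem fun i _ => Submodule.subset_span
    ⟨i, _, hcomp_mem_gpart hN (lc_mem hf _) _, rfl⟩

lemma isGraded_range_lc (hf : ∀ k, hcomp (fun _ => 1) D (s k) (f k) = f k) :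
    IsGraded D (LinearMap.range (lc f)) := by
  rintro _ ⟨g, rfl⟩ j
  rw [degreeComponent_eq, hcomp_lc hf]
  exact ⟨_, rfl⟩

lemma isGraded_ker_lc (hf : ∀ k, hcomp (fun _ => 1) D (s k) (f k) = f k) :
    IsGraded s (LinearMap.ker (lc f)) := by
  intro g hg j
  rw [LinearMap.mem_ker] at hg ⊢
  rw [degreeComponent_eq, ← hcomp_lc hf, hg, map_zero]

lemma IsMinCover.isGraded (h : IsMinCover D N s f) : IsGraded D N :=
  h.range ▸ isGraded_range_lc h.hom

lemma IsMinCover.mem (h : IsMinCover D N s f) (k : Fin r) : f k ∈ N := by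
  classical
  rw [← h.range]
  exact ⟨Pi.single k 1, by simp⟩

lemma C_smul (a : K) (x : FreeMod K n m) : (C a : MvPolynomial (Fin n) K) • x = a • x := by
  rw [← algebraMap_eq, algebraMap_smul]

/-- The number of generators of degree `j` in a minimal cover. -/
lemma IsMinCover.card_add_finrank (h : IsMinCover D N s f) (j : ℤ) :
    Nat.card {k // s k = j} + Module.finrank K (mulVars D N j) =
      Module.finrank K (gpart D N j) := by
  classical
  -- The generators of degree `j` will be shown to be a basis of a complement of (𝔪N)_j in N_j.
  set b : {k // s k = j} → FreeMod K n m := fun k => f k with hb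
  have hext : ∀ c : {k // s k = j} → K, ∑ k, c k • b k =
      lc f (fun k => if hk : s k = j then C (c ⟨k, hk⟩) else 0) := by
    intro c
    rw [lc_apply, ← Finset.sum_subset (Finset.subset_univ (Finset.univ.filter fun k => s k = j)),
      Finset.sum_subtype (p := fun k => s k = j) _ (by simp)]
    · refine Finset.sum_congr rfl fun k _ => ?_
      rw [dif_pos k.2, C_smul]
    · intro k _ hk
      rw [dif_neg (by simpa using hk), zero_smul]
  have hzero : ∀ (c : {k // s k = j} → K) (g : FreeMod K n r),
      (∀ k, g k ∈ idealOfVars (Fin n) K) → ∑ k, c k • b k = lc f g → ∀ k, c k = 0 := by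
    intro c g hg hc k
    rw [hext, ← sub_eq_zero, ← map_sub] at hc
    have h1 := h.min _ hc k
    have h2 := add_mem h1 (hg k)
    simp only [Pi.sub_apply, sub_add_cancel, k.2, dif_pos] at h2
    simpa [mem_idealOfVars_iff] using h2
  have hind : LinearIndependent K b := by
    rw [Fintype.linearIndependent_iff]
    intro c hc
    exact hzero c 0 (fun k => zero_mem _) (by rw [hc, map_zero])
  have hinf : Submodule.span K (Set.range b) ⊓ mulVars D N j = ⊥ := by
    rw [eq_bot_iff]
    rintro x ⟨hx1, hx2⟩
    rw [SetLike.mem_coe, Submodule.mem_span_range_iff_exists_fun] at hx1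
    obtain ⟨c, rfl⟩ := hx1
    have hx3 : ∀ z ∈ mulVars D N j, ∃ g : FreeMod K n r,
        (∀ k, g k ∈ idealOfVars (Fin n) K) ∧ z = lc f g := by
      intro z hz
      induction hz using Submodule.span_induction with
      | mem z hz =>
        obtain ⟨i, y, hy, rfl⟩ := hz
        have hyN := (mem_gpart.1 hy).1
        rw [← h.range] at hyN
        obtain ⟨g, rfl⟩ := hyN
        refine ⟨(X i : MvPolynomial (Fin n) K) • g, fun k => ?_, by rw [map_smul]⟩
        exact Ideal.mul_mem_right _ _ (Ideal.subset_span ⟨i, rfl⟩)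
      | zero => exact ⟨0, fun k => zero_mem _, by rw [map_zero]⟩
      | add y z _ _ hy hz =>
        obtain ⟨g, hg, rfl⟩ := hy
        obtain ⟨g', hg', rfl⟩ := hz
        exact ⟨g + g', fun k => add_mem (hg k) (hg' k), by rw [map_add]⟩
      | smul a z _ hz =>
        obtain ⟨g, hg, rfl⟩ := hz
        exact ⟨(C a : MvPolynomial (Fin n) K) • g, fun k => Ideal.mul_mem_left _ _ (hg k),
          by rw [map_smul, C_smul]⟩
    obtain ⟨g, hg, hgx⟩ := hx3 _ hx2
    have := hzero c g hg hgx
    simp [this]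
  have hsup : Submodule.span K (Set.range b) ⊔ mulVars D N j = gpart D N j := by
    refine le_antisymm (sup_le (Submodule.span_le.2 ?_) (mulVars_le_gpart j)) fun x hx => ?_
    · rintro _ ⟨k, rfl⟩
      refine mem_gpart.2 ⟨h.mem k, ?_⟩
      have := h.hom k
      rwa [k.2] at this
    · obtain ⟨hxN, hxj⟩ := mem_gpart.1 hx
      rw [← h.range] at hxN
      obtain ⟨g, hg⟩ := hxN
      set x₀ : FreeMod K n m := ∑ k : {k // s k = j}, coeff 0 (g k) • b k with hx₀
      have hx₀s : x₀ ∈ Submodule.span K (Set.range b) :=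
        sum_mem fun k _ => Submodule.smul_mem _ _ (Submodule.subset_span ⟨k, rfl⟩)
      have hx₀j : hcomp (fun _ => 1) D j x₀ = x₀ := by
        rw [hx₀, map_sum]
        refine Finset.sum_congr rfl fun k _ => ?_
        have := h.hom k
        rw [k.2] at this
        rw [map_smul, this]
      -- The degree `j` part of `g` has a constant term at `k` only if `s k = j`; subtracting these
      -- constants leaves coefficients in the ideal of the variables.
      have hd : x - x₀ = lc f (hcomp (fun _ => 1) s j g -
          fun k => if s k = j then C (coeff 0 (g k)) else 0) := by
        rw [map_sub, ← hcomp_lc h.hom, hg, hxj, hx₀, hext]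
        congr 2
      have hmem : x - x₀ ∈ mulVars D N j := by
        have hj : hcomp (fun _ => 1) D j (x - x₀) = x - x₀ := by rw [map_sub, hxj, hx₀j]
        rw [hd] at hj ⊢
        refine lc_mem_mulVars h.isGraded h.mem (fun k => ?_) hj
        rw [mem_idealOfVars_iff, Pi.sub_apply, coeff_sub, coeff_hcomp]
        simp only [map_zero, zero_add]
        split_ifs <;> simp
      have := add_mem (Submodule.mem_sup_left (T := mulVars D N j) hx₀s)
        (Submodule.mem_sup_right (S := Submodule.span K (Set.range b)) hmem)
      rwa [add_sub_cancel] at this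
  have hfin : FiniteDimensional K (Submodule.span K (Set.range b)) :=
    FiniteDimensional.span_of_finite K (Set.finite_range b)
  have := Submodule.finrank_sup_add_finrank_inf_eq (Submodule.span K (Set.range b))
    (mulVars D N j)
  rw [hinf, hsup, finrank_bot, add_zero, finrank_span_eq_card hind] at this
  rw [this, Nat.card_eq_fintype_card]

/-- Any preimages of the `f k` can be truncated to their components of degree `s k`, since `lc f'`
respects degrees. -/
lemma exists_hom_lift (hf : ∀ k, hcomp (fun _ => 1) D (s k) (f k) = f k)
    (hf' : ∀ k, hcomp (fun _ => 1) D (s' k) (f' k) = f' k)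
    (h : ∀ k, f k ∈ LinearMap.range (lc f')) :
    ∃ t : Fin r → FreeMod K n r', (∀ k, hcomp (fun _ => 1) s' (s k) (t k) = t k) ∧
      ∀ g, lc f' (lc t g) = lc f g := by
  choose c hc using h
  refine ⟨fun k => hcomp (fun _ => 1) s' (s k) (c k), fun k => hcomp_idem _ _, fun g => ?_⟩
  rw [lc_apply _ g, lc_apply _ g, map_sum]
  refine Finset.sum_congr rfl fun k _ => ?_
  rw [map_smul, ← hcomp_lc hf', hc, hf]

/-- Graded Nakayama for endomorphisms of a graded free module. -/
lemma surjective_of_sub_mem {T : FreeMod K n r →ₗ[MvPolynomial (Fin n) K] FreeMod K n r}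
    (hT : ∀ j g, hcomp (fun _ => 1) s j (T g) = T (hcomp (fun _ => 1) s j g))
    (h : ∀ g k, (g - T g) k ∈ idealOfVars (Fin n) K) : Function.Surjective T := by
  obtain ⟨B, hB'⟩ : ∃ B : ℤ, ∀ k, B ≤ s k := by
    obtain ⟨B, hB⟩ := (Finset.univ.image fun k => -s k).exists_le
    refine ⟨-B, fun k => ?_⟩
    have := hB (-s k) (Finset.mem_image_of_mem _ (Finset.mem_univ k))
    omega
  -- Induction on degree above the lower bound `B`: `g - T g` is a combination of variables times
  -- elements of degree one less.
  have key : ∀ d : ℕ, ∀ j < B + d, ∀ g, hcomp (fun _ => 1) s j g = g → g ∈ LinearMap.range T := by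
    intro d
    induction d with
    | zero =>
      intro j hj g hg
      have : g = 0 := by
        rw [← hg]
        refine ext_coeff fun k u => ?_
        rw [coeff_hcomp, if_neg]
        · rfl
        · have := weight_nonneg (ν := fun _ : Fin n => (1 : ℤ)) (by simp) u
          have := hB' k
          push_cast at hj
          omega
      rw [this]
      exact zero_mem _
    | succ d ih =>
      intro j hj g hg
      obtain ⟨q, hq⟩ := exists_eq_sum_X_smul (h g)
      have h1 : hcomp (fun _ => 1) s j (g - T g) = g - T g := by rw [map_sub, hT, hg]
      have h2 : g - T g ∈ LinearMap.range T := by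
        rw [← h1, hq, map_sum]
        refine sum_mem fun i _ => ?_
        rw [hcomp_X_smul]
        exact Submodule.smul_mem _ _ (ih (j - 1) (by push_cast at hj; omega) _ (hcomp_idem _ _))
      have := add_mem h2 (LinearMap.mem_range_self T g)
      rwa [sub_add_cancel] at this
  intro g
  change g ∈ (LinearMap.range T).restrictScalars K
  refine mem_of_hcomp_mem (fun _ => 1) s fun j => ?_
  exact key (j - B + 1).toNat j (by omega) _ (hcomp_idem _ _)

/-- Two minimal covers of the same module are isomorphic. -/
lemma IsMinCover.exists_equiv (h : IsMinCover D N s f) (h' : IsMinCover D N s' f') :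
    ∃ Φ : FreeMod K n r ≃ₗ[MvPolynomial (Fin n) K] FreeMod K n r',
      (∀ j g, hcomp (fun _ => 1) s' j (Φ g) = Φ (hcomp (fun _ => 1) s j g)) ∧
      ∀ g, lc f' (Φ g) = lc f g := by
  obtain ⟨t, ht, hft⟩ := exists_hom_lift h.hom h'.hom (fun k => by rw [h'.range]; exact h.mem k)
  obtain ⟨t', ht', hft'⟩ := exists_hom_lift h'.hom h.hom (fun k => by rw [h.range]; exact h'.mem k)
  -- The composite differs from the identity by elements of the kernel of `lc f`, whose entries lie
  -- in the ideal of the variables by minimality.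
  have h1 : Function.Surjective (lc t' ∘ₗ lc t) := by
    refine surjective_of_sub_mem (s := s) (fun j g => ?_) fun g k => h.min _ ?_ k
    · rw [LinearMap.comp_apply, hcomp_lc ht', hcomp_lc ht]; rfl
    · rw [map_sub, LinearMap.comp_apply, hft', hft, sub_self]
  have h2 : Function.Surjective (lc t ∘ₗ lc t') := by
    refine surjective_of_sub_mem (s := s') (fun j g => ?_) fun g k => h'.min _ ?_ k
    · rw [LinearMap.comp_apply, hcomp_lc ht, hcomp_lc ht']; rfl
    · rw [map_sub, LinearMap.comp_apply, hft, hft', sub_self]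
  have h3 := IsNoetherian.injective_of_surjective_endomorphism _ h1
  rw [LinearMap.coe_comp] at h2 h3
  refine ⟨LinearEquiv.ofBijective (lc t) ⟨h3.of_comp, h2.of_comp⟩, fun j g => ?_, hft⟩
  exact hcomp_lc ht j g

lemma weight_one_eq_degree (u : Fin n →₀ ℕ) :
    Finsupp.weight (fun _ : Fin n => (1 : ℤ)) u = (u.degree : ℤ) := by
  simp [Finsupp.weight_apply, Finsupp.degree_apply, Finsupp.sum]

lemma hcomp_apply_self (s : Fin r → ℤ) (g : FreeMod K n r) (k : Fin r) :
    hcomp (fun _ => 1) s (s k) g k = C (coeff 0 (g k)) := by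
  ext u
  rw [coeff_hcomp, coeff_C]
  have : Finsupp.weight (fun _ : Fin n => (1 : ℤ)) u + s k = s k ↔ 0 = u := by
    rw [weight_one_eq_degree, eq_comm (a := (0 : Fin n →₀ ℕ)), ← Finsupp.degree_eq_zero_iff]
    omega
  simp only [this]
  split_ifs with h
  · rw [← h]
  · rfl

/-- Linearly independent elements of a single degree minimally generate their span. -/
lemma isMinCover_of_linearIndependent {a : ℤ} (hf : ∀ k, hcomp (fun _ => 1) D a (f k) = f k)
    (hind : LinearIndependent K f) (hN : LinearMap.range (lc f) = N) :
    IsMinCover D N (fun _ => a) f := by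
  refine ⟨hf, hN, fun g hg k => ?_⟩
  have h1 := hcomp_lc (s := fun _ => a) hf a g
  rw [hg, map_zero, lc_apply] at h1
  have h2 : ∀ k, hcomp (fun _ => 1) (fun _ => a) a g k = C (coeff 0 (g k)) :=
    hcomp_apply_self (fun _ => a) g
  simp only [h2, C_smul] at h1
  rw [mem_idealOfVars_iff]
  exact Fintype.linearIndependent_iff.1 hind (fun k => coeff 0 (g k)) h1.symm k

lemma exists_hom_generators (hN : IsGraded D N) :
    ∃ (r : ℕ) (s : Fin r → ℤ) (f : Fin r → FreeMod K n m),
      (∀ k, hcomp (fun _ => 1) D (s k) (f k) = f k) ∧ LinearMap.range (lc f) = N := by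
  have hspan : Submodule.span (MvPolynomial (Fin n) K)
      {x | x ∈ N ∧ ∃ j, hcomp (fun _ => 1) D j x = x} = N := by
    refine le_antisymm (Submodule.span_le.2 fun x hx => hx.1) fun x hx => ?_
    rw [← Submodule.restrictScalars_mem K]
    exact mem_of_hcomp_mem (fun _ => 1) D fun j =>
      Submodule.subset_span ⟨hN x hx j, j, hcomp_idem _ _⟩
  have hfg : N.FG := IsNoetherian.noetherian N
  rw [← hspan, Submodule.fg_span_iff_fg_span_finset_subset] at hfg
  obtain ⟨S, hS, hSN⟩ := hfg
  have hdeg : ∀ x : S, ∃ j, hcomp (fun _ => 1) D j (x : FreeMod K n m) = x := fun x => (hS x.2).2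
  choose j hj using hdeg
  refine ⟨S.card, fun k => j (S.equivFin.symm k), fun k => (S.equivFin.symm k : S),
    fun k => hj _, ?_⟩
  rw [Fintype.range_linearCombination, ← hspan, hSN]
  congr 1
  rw [show (fun k => ((S.equivFin.symm k : S) : FreeMod K n m)) =
    Subtype.val ∘ S.equivFin.symm from rfl, Set.range_comp,
    S.equivFin.symm.surjective.range_eq, Set.image_univ]
  exact Subtype.range_coe

/-- A homogeneous generating family of least size works: a relation with a nonzero constant
coefficient would make one generator redundant. -/
lemma exists_isMinCover (hN : IsGraded D N) :
    ∃ (r : ℕ) (s : Fin r → ℤ) (f : Fin r → FreeMod K n m), IsMinCover D N s f := by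
  classical
  have hex := exists_hom_generators hN
  obtain ⟨s, f, hf, hfN⟩ := Nat.find_spec hex
  refine ⟨_, s, f, hf, hfN, fun g hg k => ?_⟩
  by_contra hk
  rw [mem_idealOfVars_iff] at hk
  generalize hr : Nat.find hex = r at s f g k hf hfN hg hk
  cases r with
  | zero => exact k.elim0
  | succ r =>
    refine Nat.find_min hex (m := r) (by omega)
      ⟨fun l => s (k.succAbove l), fun l => f (k.succAbove l), fun l => hf _, ?_⟩
    rw [← hfN, Fintype.range_linearCombination, Fintype.range_linearCombination]
    refine le_antisymm (Submodule.span_mono ?_) (Submodule.span_le.2 ?_)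
    · rintro _ ⟨l, rfl⟩
      exact ⟨_, rfl⟩
    · have hothers : ∀ l, f (k.succAbove l) ∈
          Submodule.span (MvPolynomial (Fin n) K) (Set.range fun l => f (k.succAbove l)) :=
        fun l => Submodule.subset_span ⟨l, rfl⟩
      rintro _ ⟨l, rfl⟩
      rcases Fin.eq_self_or_eq_succAbove k l with rfl | ⟨l, rfl⟩
      -- In the degree `s l` component of the relation, the coefficient of `f l` is a nonzero
      -- scalar, so `f l` can be solved for.
      · have h1 := hcomp_lc hf (s l) g
        rw [hg, map_zero, lc_apply, Fin.sum_univ_succAbove _ l] at h1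
        rw [hcomp_apply_self, C_smul] at h1
        have h3 := eq_neg_of_add_eq_zero_left h1.symm
        have h4 : f l = (coeff 0 (g l))⁻¹ • (coeff 0 (g l) • f l) := by
          rw [smul_smul, inv_mul_cancel₀ hk, one_smul]
        rw [h4, h3, ← C_smul]
        exact Submodule.smul_mem _ _ (neg_mem (sum_mem fun i _ =>
          Submodule.smul_mem _ _ (hothers i)))
      · exact hothers l

end MinimalCovers

/-! ### Minimal graded free resolutions -/

section Resolutions

variable {K : Type*} [Field K] {n m r r' : ℕ} {D : Fin m → ℤ}
  {N : Submodule (MvPolynomial (Fin n) K) (FreeMod K n m)}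
  {s : Fin r → ℤ} {f : Fin r → FreeMod K n m}

lemma lc_single_one (T : FreeMod K n r →ₗ[MvPolynomial (Fin n) K] FreeMod K n m) :
    lc (fun k => T (Pi.single k 1)) = T := by
  ext k : 2
  simp

namespace MinimalGradedFreeResolution

lemma isMinCover (P : MinimalGradedFreeResolution D N) :
    IsMinCover D N (P.shift 0) (fun k => P.aug (Pi.single k 1)) where
  hom k := mem_degreePart.1 (P.aug_homogeneous k)
  range := by rw [lc_single_one, P.range_aug]
  min g hg k := by
    rw [lc_single_one, ← LinearMap.mem_ker, P.exact_aug] at hg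
    obtain ⟨x, rfl⟩ := hg
    exact P.minimal 0 x k

/-- The resolution of the first syzygy module obtained from a resolution. -/
def tail (P : MinimalGradedFreeResolution D N) :
    MinimalGradedFreeResolution (P.shift 0) (LinearMap.ker P.aug) where
  rank i := P.rank (i + 1)
  shift i := P.shift (i + 1)
  aug := P.d 0
  d i := P.d (i + 1)
  aug_homogeneous := P.d_homogeneous 0
  d_homogeneous i := P.d_homogeneous (i + 1)
  range_aug := P.exact_aug.symm
  exact_aug := P.exact_d 0
  exact_d i := P.exact_d (i + 1)
  minimal i := P.minimal (i + 1)

/-- Transport of a resolution along a graded isomorphism of the ambient free modules. -/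
def transport {D' : Fin r → ℤ} {N' : Submodule (MvPolynomial (Fin n) K) (FreeMod K n r)}
    (P : MinimalGradedFreeResolution D N)
    (Φ : FreeMod K n m ≃ₗ[MvPolynomial (Fin n) K] FreeMod K n r)
    (hΦ : ∀ j g, hcomp (fun _ => 1) D' j (Φ g) = Φ (hcomp (fun _ => 1) D j g))
    (hN : N.map Φ.toLinearMap = N') : MinimalGradedFreeResolution D' N' where
  rank := P.rank
  shift := P.shift
  aug := Φ.toLinearMap ∘ₗ P.aug
  d := P.d
  aug_homogeneous k := by
    rw [mem_degreePart]
    refine (hΦ _ _).trans ?_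
    rw [mem_degreePart.1 (P.aug_homogeneous k)]
    rfl
  d_homogeneous := P.d_homogeneous
  range_aug := by rw [LinearMap.range_comp, P.range_aug, hN]
  exact_aug := by rw [LinearEquiv.ker_comp, P.exact_aug]
  exact_d := P.exact_d
  minimal := P.minimal

/-- The resolution of the syzygy module of a minimal cover obtained from a resolution. -/
lemma exists_syzygy (P : MinimalGradedFreeResolution D N) (h : IsMinCover D N s f) :
    ∃ Q : MinimalGradedFreeResolution s (LinearMap.ker (lc f)),
      ∀ i j, Nat.card {k // Q.shift i k = j} = Nat.card {k // P.shift (i + 1) k = j} := by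
  obtain ⟨Φ, h1, h2⟩ := P.isMinCover.exists_equiv h
  rw [lc_single_one] at h2
  refine ⟨P.tail.transport Φ h1 ?_, fun i j => rfl⟩
  ext x
  constructor
  · rintro ⟨y, hy, rfl⟩
    exact (h2 y).trans hy
  · intro hx
    refine ⟨Φ.symm x, ?_, Φ.apply_symm_apply x⟩
    change P.aug _ = 0
    rw [← h2, Φ.apply_symm_apply]
    exact hx

end MinimalGradedFreeResolution

/-- The graded Betti numbers do not depend on the resolution. -/
lemma card_shift_eq (i : ℕ) (j : ℤ) : ∀ {m : ℕ} {D : Fin m → ℤ}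
    {N : Submodule (MvPolynomial (Fin n) K) (FreeMod K n m)}
    (P Q : MinimalGradedFreeResolution D N),
    Nat.card {k // P.shift i k = j} = Nat.card {k // Q.shift i k = j} := by
  induction i with
  | zero =>
    intro m D N P Q
    have h1 := P.isMinCover.card_add_finrank j
    have h2 := Q.isMinCover.card_add_finrank j
    omega
  | succ i ih =>
    intro m D N P Q
    -- Both tails are moved to the syzygies of one common cover, so that the induction hypothesis
    -- compares resolutions of the same module.
    obtain ⟨S, hP⟩ := P.exists_syzygy P.isMinCover
    obtain ⟨T, hQ⟩ := Q.exists_syzygy P.isMinCover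
    rw [← hP, ← hQ]
    exact ih S T

/-- A graded submodule of some graded free module. -/
structure GradedSubmodule (K : Type*) [Field K] (n : ℕ) where
  ambientRank : ℕ
  deg : Fin ambientRank → ℤ
  carrier : Submodule (MvPolynomial (Fin n) K) (FreeMod K n ambientRank)
  isGraded : IsGraded deg carrier

namespace GradedSubmodule

lemma exists_syzygy (S : GradedSubmodule K n) : ∃ (T : GradedSubmodule K n)
    (f : Fin T.ambientRank → FreeMod K n S.ambientRank),
    IsMinCover S.deg S.carrier T.deg f ∧ T.carrier = LinearMap.ker (lc f) := by
  obtain ⟨r, s, f, h⟩ := exists_isMinCover S.isGraded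
  exact ⟨⟨r, s, LinearMap.ker (lc f), isGraded_ker_lc h.hom⟩, f, h, rfl⟩

/-- A first syzygy module. -/
def syzygy (S : GradedSubmodule K n) : GradedSubmodule K n := S.exists_syzygy.choose

/-- Minimal homogeneous generators, with relation module `S.syzygy`. -/
def gens (S : GradedSubmodule K n) : Fin S.syzygy.ambientRank → FreeMod K n S.ambientRank :=
  S.exists_syzygy.choose_spec.choose

lemma gens_isMinCover (S : GradedSubmodule K n) :
    IsMinCover S.deg S.carrier S.syzygy.deg S.gens := S.exists_syzygy.choose_spec.choose_spec.1

lemma syzygy_carrier (S : GradedSubmodule K n) : S.syzygy.carrier = LinearMap.ker (lc S.gens) :=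
  S.exists_syzygy.choose_spec.choose_spec.2

lemma lc_gens_single_mem (S : GradedSubmodule K n) (k : Fin S.syzygy.ambientRank) :
    lc S.gens (Pi.single k 1) ∈ degreePart K n S.deg (S.syzygy.deg k) := by
  rw [Fintype.linearCombination_apply_single, one_smul, mem_degreePart]
  exact S.gens_isMinCover.hom k

/-- Iterated syzygy modules. -/
def iterSyzygy (S : GradedSubmodule K n) : ℕ → GradedSubmodule K n
  | 0 => S
  | i + 1 => (S.iterSyzygy i).syzygy

/-- The minimal resolution built from iterated syzygies. -/
def resolution (S : GradedSubmodule K n) : MinimalGradedFreeResolution S.deg S.carrier where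
  rank i := (S.iterSyzygy (i + 1)).ambientRank
  shift i := (S.iterSyzygy (i + 1)).deg
  aug := lc S.gens
  d i := lc (S.iterSyzygy (i + 1)).gens
  aug_homogeneous := S.lc_gens_single_mem
  d_homogeneous i := (S.iterSyzygy (i + 1)).lc_gens_single_mem
  range_aug := S.gens_isMinCover.range
  exact_aug := S.syzygy_carrier.symm.trans S.syzygy.gens_isMinCover.range.symm
  exact_d i := (S.iterSyzygy (i + 1)).syzygy_carrier.symm.trans
    (S.iterSyzygy (i + 1)).syzygy.gens_isMinCover.range.symm
  minimal i x k := by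
    have h1 : lc (S.iterSyzygy (i + 1)).gens x ∈ (S.iterSyzygy (i + 1)).carrier := by
      rw [← (S.iterSyzygy (i + 1)).gens_isMinCover.range]
      exact ⟨x, rfl⟩
    have h2 : (S.iterSyzygy (i + 1)).carrier = LinearMap.ker (lc (S.iterSyzygy i).gens) :=
      (S.iterSyzygy i).syzygy_carrier
    rw [h2] at h1
    exact (S.iterSyzygy i).gens_isMinCover.min _ h1 k

end GradedSubmodule

lemma nonempty_resolution (hN : IsGraded D N) : Nonempty (MinimalGradedFreeResolution D N) :=
  ⟨(⟨m, D, N, hN⟩ : GradedSubmodule K n).resolution⟩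

lemma gradedBetti_eq (P : MinimalGradedFreeResolution D N) (i : ℕ) (j : ℤ) :
    gradedBetti D N i j = Nat.card {k // P.shift i k = j} := by
  have : {b | ∃ P : MinimalGradedFreeResolution D N, Nat.card {k // P.shift i k = j} = b} =
      {Nat.card {k // P.shift i k = j}} := by
    ext b
    constructor
    · rintro ⟨Q, rfl⟩
      exact card_shift_eq i j Q P
    · rintro rfl
      exact ⟨P, rfl⟩
  rw [gradedBetti, this, csInf_singleton]

lemma gradedBetti_zero_eq (h : IsMinCover D N s f) (j : ℤ) :
    gradedBetti D N 0 j = Nat.card {k // s k = j} := by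
  obtain ⟨P⟩ := nonempty_resolution h.isGraded
  rw [gradedBetti_eq P]
  have h1 := P.isMinCover.card_add_finrank j
  have h2 := h.card_add_finrank j
  omega

lemma gradedBetti_succ (h : IsMinCover D N s f) (i : ℕ) (j : ℤ) :
    gradedBetti D N (i + 1) j = gradedBetti s (LinearMap.ker (lc f)) i j := by
  obtain ⟨P⟩ := nonempty_resolution h.isGraded
  obtain ⟨Q, hQ⟩ := P.exists_syzygy h
  rw [gradedBetti_eq P, gradedBetti_eq Q, hQ]

lemma IsMinCover.card_eq (h : IsMinCover D N s f) {s' : Fin r' → ℤ}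
    {f' : Fin r' → FreeMod K n m} (h' : IsMinCover D N s' f') : r = r' := by
  obtain ⟨Φ, -⟩ := h.exists_equiv h'
  simpa using LinearEquiv.finrank_eq Φ

lemma betti_zero_eq (h : IsMinCover D N s f) : betti D N 0 = r := by
  have : {b | ∃ P : MinimalGradedFreeResolution D N, P.rank 0 = b} = {r} := by
    ext b
    constructor
    · rintro ⟨Q, rfl⟩
      exact Q.isMinCover.card_eq h
    · rintro rfl
      obtain ⟨P⟩ := nonempty_resolution h.isGraded
      exact ⟨P, P.isMinCover.card_eq h⟩
  rw [betti, this, csInf_singleton]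

/-! ### Linear resolutions -/

lemma regularity_le_iff (a : ℤ) :
    regularity D N ≤ ((a : ℝ) : EReal) ↔ ∀ (i : ℕ) (j : ℤ), a + i < j → gradedBetti D N i j = 0 := by
  simp only [regularity, iSup_le_iff, EReal.coe_le_coe_iff, Int.cast_le]
  constructor
  · intro h i j hj
    by_contra h0
    have := h i j h0
    omega
  · intro h i j h0
    by_contra hlt
    exact h0 (h i j (by omega))

/-- If linearly independent forms of degree `a` generate a module with a linear resolution, then
their syzygy module is generated in degree `a + 1`. -/
lemma ker_le_span_of_linear {a : ℤ} (h : IsMinCover D N (fun _ : Fin r => a) f)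
    (hlin : ∀ (i : ℕ) (j : ℤ), a + i < j → gradedBetti D N i j = 0) :
    LinearMap.ker (lc f) ≤ generatedInDegree (fun _ => a) (a + 1) (LinearMap.ker (lc f)) := by
  obtain ⟨t, s', f', h'⟩ := exists_isMinCover (isGraded_ker_lc h.hom)
  conv_lhs => rw [← h'.range, Fintype.range_linearCombination]
  rw [Submodule.span_le]
  rintro _ ⟨k, rfl⟩
  refine Submodule.subset_span ⟨h'.mem k, ?_⟩
  rw [mem_degreePart]
  have hhom := h'.hom k
  suffices s' k = a + 1 by rwa [this] at hhom
  refine le_antisymm ?_ ?_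
  -- A minimal syzygy of degree above `a + 1` would contribute to β₁.
  · by_contra hlt
    have h0 := hlin 1 (s' k) (by push_cast; omega)
    rw [gradedBetti_succ h, gradedBetti_zero_eq h', Nat.card_eq_zero] at h0
    rcases h0 with h0 | h0
    · exact h0.false ⟨k, rfl⟩
    · exact not_finite_iff_infinite.2 h0 inferInstance
  · by_contra hlt
    -- In degree at most `a` the entries can only be constants, which minimality kills; but a
    -- minimal generator is nonzero.
    have hz : f' k = 0 := by
      refine ext_coeff fun l u => ?_
      rw [← hhom, coeff_hcomp]
      split_ifs with hu
      · rw [weight_one_eq_degree] at hu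
        have hu0 : u = 0 := by
          rw [← Finsupp.degree_eq_zero_iff]
          omega
        rw [hu0]
        exact mem_idealOfVars_iff.1 (h.min _ (h'.mem k) l)
      · rfl
    have h1 := h'.min (Pi.single k 1) (by simp [hz]) k
    rw [mem_idealOfVars_iff] at h1
    simp at h1

end Resolutions

/-! ### Componentwise linearity and initial modules -/

section Main

variable {K : Type*} [Field K] {n m r : ℕ} {D : Fin m → ℤ} {ω : Fin n → ℕ} {ε : Fin m → ℕ}
  {M N : Submodule (MvPolynomial (Fin n) K) (FreeMod K n m)}

lemma hcomp_mem_inn_gpart (hM : IsGraded D M) {x : FreeMod K n m} {ν : Fin n → ℤ} {E : Fin m → ℤ}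
    (hx : x ∈ inn ν E (M.restrictScalars K)) (j : ℤ) :
    hcomp (fun _ => 1) D j x ∈ inn ν E (gpart D M j) := by
  intro w
  obtain ⟨y, h1, h2, h3⟩ := hx w
  exact ⟨_, hcomp_mem_gpart hM h1 j, hcomp_mem_wlt_of_mem h2, by rw [hcomp_comm, h3, hcomp_comm]⟩

lemma isGraded_initialModule (hM : IsGraded D M) : IsGraded D (initialModule ω ε M) :=
  fun _ hx j => inn_le_initialModule (fun _ hy => (mem_gpart.1 hy).1)
    (hcomp_mem_inn_gpart hM (mem_initialModule.1 hx) j)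

/-- Degree components of a lift of an initial form are again lifts, by commutation of the two
gradings. -/
lemma inn_gpart (hM : IsGraded D M) (j : ℤ) :
    inn (fun i => (ω i : ℤ)) (fun k => (ε k : ℤ)) (gpart D M j) =
      gpart D (initialModule ω ε M) j := by
  refine le_antisymm (fun x hx => mem_gpart.2
    ⟨inn_le_initialModule (fun _ hy => (mem_gpart.1 hy).1) hx, ?_⟩) fun x hx => ?_
  · rw [← sub_eq_zero]
    refine eq_zero_of_hcomp_eq_zero (fun i => (ω i : ℤ)) (fun k => (ε k : ℤ)) fun w => ?_
    obtain ⟨y, h1, -, h3⟩ := hx w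
    rw [map_sub, hcomp_comm, ← h3, hcomp_comm, (mem_gpart.1 h1).2, sub_self]
  · obtain ⟨h1, h2⟩ := mem_gpart.1 hx
    rw [← h2]
    exact hcomp_mem_inn_gpart hM (mem_initialModule.1 h1) j

lemma range_lc_eq_generatedInDegree {a : ℤ} {f : Fin r → FreeMod K n m}
    (hf : Submodule.span K (Set.range f) = gpart D N a) :
    LinearMap.range (lc f) = generatedInDegree D a N := by
  have hset : {x | x ∈ N ∧ x ∈ degreePart K n D a} = (gpart D N a : Set (FreeMod K n m)) := rfl
  rw [Fintype.range_linearCombination, generatedInDegree, hset, ← hf,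
    Submodule.span_span_of_tower]

lemma generatedInDegree_le (a : ℤ) : generatedInDegree D a N ≤ N :=
  Submodule.span_le.2 fun _ hx => hx.1

lemma generatedInDegree_idem (a : ℤ) :
    generatedInDegree D a N ≤ generatedInDegree D a (generatedInDegree D a N) :=
  Submodule.span_mono fun _ hx => ⟨Submodule.subset_span hx, hx.2⟩

lemma isGraded_generatedInDegree (a : ℤ) : IsGraded D (generatedInDegree D a N) := by
  obtain ⟨r, b⟩ : ∃ r, Nonempty (Module.Basis (Fin r) K (gpart D N a)) :=
    ⟨_, ⟨Module.finBasis K (gpart D N a)⟩⟩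
  obtain ⟨b⟩ := b
  have hspan : Submodule.span K (Set.range fun k => (b k : FreeMod K n m)) = gpart D N a := by
    rw [show (fun k => (b k : FreeMod K n m)) = (gpart D N a).subtype ∘ b from rfl,
      Set.range_comp, Submodule.span_image, b.span_eq, Submodule.map_top, Submodule.range_subtype]
  rw [← range_lc_eq_generatedInDegree hspan]
  exact isGraded_range_lc (s := fun _ => a) fun k => (mem_gpart.1 (b k).2).2

/-! ### Syzygies of initial forms versus initial forms of syzygies -/

section Lifting

variable {ν : Fin n → ℤ} {E : Fin m → ℤ} {f p : Fin r → FreeMod K n m} {e : Fin r → ℤ}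

/-- Syzygies of the initial forms lift as soon as standard representations exist. -/
lemma mem_inn_ker (hν : ∀ i, 0 ≤ ν i) (hE : ∀ k, 0 ≤ E k)
    (hf : ∀ k, f k ∈ wlt ν E (e k + 1)) (hp : ∀ k, hcomp ν E (e k) (f k) = p k)
    {W : Submodule K (FreeMod K n m)}
    (hW : ∀ w, ∀ h ∈ W, h ∈ wlt ν E (w + 1) → ∃ c : FreeMod K n r,
      lc p c = hcomp ν E w h ∧ hcomp ν e w c = c ∧ lc f c ∈ W)
    {x : FreeMod K n r} (hx : lc p x = 0) (hxW : ∀ w, lc f (hcomp ν e w x) ∈ W) :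
    x ∈ inn ν e ((LinearMap.ker (lc f)).restrictScalars K) := by
  intro w
  have hxw : hcomp ν e w x ∈ wlt ν e (w + 1) := hcomp_mem_wlt _ _
  -- As `x` is a syzygy of `p`, the component of weight `w` cancels. A standard representation `g`
  -- of what remains has smaller weight, so subtracting it gives a true syzygy with the same leading
  -- part.
  have h1 : lc f (hcomp ν e w x) ∈ wlt ν E w := by
    refine mem_wlt_of_hcomp_eq_zero (lc_mem_wlt hf hxw) ?_
    rw [hcomp_lc_top hf hp hxw, hcomp_idem,
      ← hcomp_lc (fun k => by rw [← hp, hcomp_idem]) w x, hx, map_zero]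
  obtain ⟨g, hg, hgf⟩ := exists_standard_repr hν hE hf hp hW w (hxW w) h1
  refine ⟨hcomp ν e w x - g, ?_, sub_mem hxw (wlt_mono (by omega) hg), ?_⟩
  · rw [Submodule.restrictScalars_mem, LinearMap.mem_ker, map_sub, hgf, sub_self]
  · rw [map_sub, hcomp_idem, hcomp_eq_zero_of_mem_wlt hg le_rfl, sub_zero]

lemma lc_eq_zero_of_mem_inn_ker (hf : ∀ k, f k ∈ wlt ν E (e k + 1))
    (hp : ∀ k, hcomp ν E (e k) (f k) = p k) {x : FreeMod K n r}
    (hx : x ∈ inn ν e ((LinearMap.ker (lc f)).restrictScalars K)) : lc p x = 0 := by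
  change x ∈ (LinearMap.ker (lc p)).restrictScalars K
  refine mem_of_hcomp_mem ν e fun w => ?_
  obtain ⟨y, h1, h2, h3⟩ := hx w
  rw [← h3, Submodule.restrictScalars_mem, LinearMap.mem_ker, ← hcomp_lc_top hf hp h2,
    show lc f y = 0 from h1, map_zero]

end Lifting

/-- If the initial module is generated in degree `a` and has a linear resolution, then so does the
module itself. -/
lemma gradedBetti_eq_zero_of_initialModule_linear (ω : Fin n → ℕ) (i : ℕ) :
    ∀ {m : ℕ} {D : Fin m → ℤ} {ε : Fin m → ℕ}
      {N : Submodule (MvPolynomial (Fin n) K) (FreeMod K n m)} {a : ℤ}, IsGraded D N →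
      initialModule ω ε N ≤ generatedInDegree D a (initialModule ω ε N) →
      (∀ (i : ℕ) (j : ℤ), a + i < j → gradedBetti D (initialModule ω ε N) i j = 0) →
      ∀ j, a + i < j → gradedBetti D N i j = 0 := by
  induction i with
  | zero => ?_
  | succ i ih => ?_
  all_goals
    intro m D ε N a hN hgen hlin j hj
    obtain ⟨r, f, p, e, hf, hp, hfi, hpi, hfs, hps⟩ := exists_basis_initial
      (ν := fun i => (ω i : ℤ)) (E := fun k => (ε k : ℤ)) (by simp) (by simp) (gpart D N a)
    rw [inn_gpart hN] at hps
    have hfN : ∀ k, f k ∈ gpart D N a := fun k => hfs ▸ Submodule.subset_span ⟨k, rfl⟩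
    have hpL : ∀ k, p k ∈ gpart D (initialModule ω ε N) a :=
      fun k => hps ▸ Submodule.subset_span ⟨k, rfl⟩
    have hL : LinearMap.range (lc p) = initialModule ω ε N := by
      rw [range_lc_eq_generatedInDegree hps]
      exact le_antisymm (generatedInDegree_le a) hgen
    -- Here reduction takes place in all of `N`, since `p` generates the whole initial module.
    have hW : ∀ w, ∀ h ∈ N.restrictScalars K,
        h ∈ wlt (fun i => (ω i : ℤ)) (fun k => (ε k : ℤ)) (w + 1) → ∃ c : FreeMod K n r,
        lc p c = hcomp (fun i => (ω i : ℤ)) (fun k => (ε k : ℤ)) w h ∧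
        hcomp (fun i => (ω i : ℤ)) (fun k => (e k : ℤ)) w c = c ∧
        lc f c ∈ N.restrictScalars K := by
      intro w h hh hw
      have h1 : hcomp (fun i => (ω i : ℤ)) (fun k => (ε k : ℤ)) w h ∈ initialModule ω ε N :=
        mem_initialModule.2 (hcomp_mem_inn hh hw)
      rw [← hL] at h1
      obtain ⟨c, hc⟩ := h1
      refine ⟨hcomp (fun i => (ω i : ℤ)) (fun k => (e k : ℤ)) w c, ?_, hcomp_idem _ _,
        lc_mem (fun k => (mem_gpart.1 (hfN k)).1) _⟩
      rw [← hcomp_lc (fun k => by rw [← hp, hcomp_idem]) w c, hc, hcomp_idem]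
    have hrange : LinearMap.range (lc f) = N := by
      refine le_antisymm ?_ fun x hx => ?_
      · rintro _ ⟨g, rfl⟩
        exact lc_mem (fun k => (mem_gpart.1 (hfN k)).1) _
      · obtain ⟨w, hw⟩ := exists_mem_wlt (fun i => (ω i : ℤ)) (fun k => (ε k : ℤ)) x
        obtain ⟨g, -, hg⟩ := exists_standard_repr (by simp) (by simp) hf hp hW w hx hw
        exact ⟨g, hg⟩
    have hcf : IsMinCover D N (fun _ => a) f :=
      isMinCover_of_linearIndependent (fun k => (mem_gpart.1 (hfN k)).2) hfi hrange
    have hcp : IsMinCover D (initialModule ω ε N) (fun _ => a) p :=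
      isMinCover_of_linearIndependent (fun k => (mem_gpart.1 (hpL k)).2) hpi hL
  · rw [gradedBetti_zero_eq hcf, Nat.card_eq_zero]
    left
    refine ⟨fun k => ?_⟩
    have := k.2
    push_cast at hj
    omega
  · have hsyz : initialModule ω e (LinearMap.ker (lc f)) = LinearMap.ker (lc p) := by
      ext x
      rw [mem_initialModule, LinearMap.mem_ker]
      exact ⟨lc_eq_zero_of_mem_inn_ker hf hp, fun hx => mem_inn_ker (by simp) (by simp) hf hp hW hx
        fun w => lc_mem (fun k => (mem_gpart.1 (hfN k)).1) _⟩
    rw [gradedBetti_succ hcf]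
    -- The basis vectors now carry the weights `e` of the initial forms, and the syzygies sit one
    -- degree higher.
    refine ih (a := a + 1) (ε := e) (isGraded_ker_lc hcf.hom) ?_ ?_ j (by push_cast at hj; omega)
    · rw [hsyz]
      exact ker_le_span_of_linear hcp hlin
    · intro i j hij
      rw [hsyz, ← gradedBetti_succ hcp]
      exact hlin _ _ (by push_cast; omega)

/-- The fibre cardinalities of both maps sum to `r`, so no termwise inequality can be strict. -/
lemma eq_of_card_fiber_le {r : ℕ} {s t : Fin r → ℤ}
    (h : ∀ j, Nat.card {k // s k = j} ≤ Nat.card {k // t k = j}) (j : ℤ) :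
    Nat.card {k // s k = j} = Nat.card {k // t k = j} := by
  classical
  set J := insert j (Finset.univ.image s ∪ Finset.univ.image t) with hJ
  have hsum : ∀ q : Fin r → ℤ, (∀ k, q k ∈ J) → ∑ j ∈ J, Nat.card {k // q k = j} = r := by
    intro q hq
    have := Finset.card_eq_sum_card_fiberwise (f := q) (s := Finset.univ) (t := J)
      (fun k _ => hq k)
    rw [Finset.card_univ, Fintype.card_fin] at this
    refine Eq.trans (Finset.sum_congr rfl fun j _ => ?_) this.symm
    rw [Nat.card_eq_fintype_card, Fintype.card_subtype]
  have h1 := hsum s (fun k => by simp [hJ])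
  have h2 := hsum t (fun k => by simp [hJ])
  exact (Finset.sum_eq_sum_iff_of_le fun j _ => h j).1 (h1.trans h2.symm) j (by simp [hJ])

/-- If `M` and its initial module have the same number of generators, then taking initial forms
commutes with multiplication by the variables. -/
lemma inn_mulVars (hM : IsGraded D M)
    (hbetti : betti D M 0 = betti D (initialModule ω ε M) 0) (j : ℤ) :
    inn (fun i => (ω i : ℤ)) (fun k => (ε k : ℤ)) (mulVars D M j) =
      mulVars D (initialModule ω ε M) j := by
  have hle : ∀ j, mulVars D (initialModule ω ε M) j ≤
      inn (fun i => (ω i : ℤ)) (fun k => (ε k : ℤ)) (mulVars D M j) := by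
    intro j
    refine Submodule.span_le.2 ?_
    rintro _ ⟨i, y, hy, rfl⟩
    rw [← inn_gpart hM] at hy
    exact X_smul_mem_inn (W := gpart D M (j - 1)) (W' := mulVars D M j) i
      (fun z hz => Submodule.subset_span ⟨i, z, hz, rfl⟩) hy
  have hfin : ∀ j, FiniteDimensional K
      (inn (fun i => (ω i : ℤ)) (fun k => (ε k : ℤ)) (mulVars D M j)) :=
    fun j => finiteDimensional_inn (by simp) (by simp) _
  have hrank : ∀ W : Submodule K (FreeMod K n m), FiniteDimensional K W → Module.finrank K
      (inn (fun i => (ω i : ℤ)) (fun k => (ε k : ℤ)) W) = Module.finrank K W :=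
    fun W _ => finrank_inn (by simp) (by simp) W
  obtain ⟨r, s, f, hf⟩ := exists_isMinCover hM
  obtain ⟨r', t, p, hp⟩ := exists_isMinCover (isGraded_initialModule (ω := ω) (ε := ε) hM)
  rw [betti_zero_eq hf, betti_zero_eq hp] at hbetti
  subst hbetti
  -- Both sides equal the dimension of M_j, which is that of in(M)_j.
  have hcard : ∀ j, Nat.card {k // s k = j} + Module.finrank K (mulVars D M j) =
      Nat.card {k // t k = j} + Module.finrank K (mulVars D (initialModule ω ε M) j) := by
    intro j
    rw [hf.card_add_finrank, hp.card_add_finrank, ← inn_gpart hM,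
      hrank (gpart D M j) inferInstance]
  have hmono : ∀ j, Module.finrank K (mulVars D (initialModule ω ε M) j) ≤
      Module.finrank K (mulVars D M j) := by
    intro j
    have := hfin j
    rw [← hrank (mulVars D M j) inferInstance]
    exact Submodule.finrank_mono (hle j)
  have heq := eq_of_card_fiber_le (s := s) (t := t) (fun j => by
    have := hcard j
    have := hmono j
    omega) j
  have := hfin j
  refine (Submodule.eq_of_le_of_finrank_eq (hle j) ?_).symm
  rw [hrank (mulVars D M j) inferInstance]
  have := hcard j
  omega

/-- If `M` and its initial module have the same number of generators and the latter is
componentwise linear, then taking initial modules commutes with taking `M_⟨a⟩`. -/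
lemma initialModule_generatedInDegree (hM : IsGraded D M)
    (hbetti : betti D M 0 = betti D (initialModule ω ε M) 0) {a : ℤ}
    (hlin : ∀ (i : ℕ) (j : ℤ), a + i < j →
      gradedBetti D (generatedInDegree D a (initialModule ω ε M)) i j = 0) :
    initialModule ω ε (generatedInDegree D a M) =
      generatedInDegree D a (initialModule ω ε M) := by
  obtain ⟨r, f, p, e, hf, hp, hfi, hpi, hfs, hps⟩ := exists_basis_initial
    (ν := fun i => (ω i : ℤ)) (E := fun k => (ε k : ℤ)) (by simp) (by simp) (gpart D M a)
  rw [inn_gpart hM] at hps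
  have hfM : ∀ k, f k ∈ gpart D M a := fun k => hfs ▸ Submodule.subset_span ⟨k, rfl⟩
  have hpI : ∀ k, p k ∈ gpart D (initialModule ω ε M) a :=
    fun k => hps ▸ Submodule.subset_span ⟨k, rfl⟩
  have hphom : ∀ k, hcomp (fun i => (ω i : ℤ)) (fun k => (ε k : ℤ)) (e k) (p k) = p k :=
    fun k => by rw [← hp, hcomp_idem]
  have hdeg_f : ∀ k, hcomp (fun _ => 1) D a (f k) = f k := fun k => (mem_gpart.1 (hfM k)).2
  have hdeg_p : ∀ k, hcomp (fun _ => 1) D a (p k) = p k := fun k => (mem_gpart.1 (hpI k)).2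
  have hL := range_lc_eq_generatedInDegree hps
  have hcp := isMinCover_of_linearIndependent hdeg_p hpi hL
  have hsmall : ∀ c : FreeMod K n r, hcomp (fun _ => 1) (fun _ => a) (a + 1) c = c →
      lc f c ∈ mulVars D M (a + 1) := by
    intro c hc
    refine lc_mem_mulVars hM (fun k => (mem_gpart.1 (hfM k)).1) (fun k => ?_) ?_
    · rw [mem_idealOfVars_iff, ← hc, coeff_hcomp, if_neg (by simp)]
    · rw [hcomp_lc (s := fun _ => a) hdeg_f, hc]
  -- Reduction is restricted to (𝔪M)_{a+1}: its initial forms lie in 𝔪 in(M)_a by `inn_mulVars`,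
  -- hence in the span of `p`. For all of M_{a+1}, new generators would obstruct this.
  have hW : ∀ w, ∀ h ∈ mulVars D M (a + 1),
      h ∈ wlt (fun i => (ω i : ℤ)) (fun k => (ε k : ℤ)) (w + 1) → ∃ c : FreeMod K n r,
      lc p c = hcomp (fun i => (ω i : ℤ)) (fun k => (ε k : ℤ)) w h ∧
      hcomp (fun i => (ω i : ℤ)) (fun k => (e k : ℤ)) w c = c ∧
      lc f c ∈ mulVars D M (a + 1) := by
    intro w h hh hw
    have h1 := hcomp_mem_inn hh hw
    rw [inn_mulVars hM hbetti] at h1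
    have h2 : hcomp (fun i => (ω i : ℤ)) (fun k => (ε k : ℤ)) w h ∈ LinearMap.range (lc p) := by
      rw [hL]
      change _ ∈ (generatedInDegree D a (initialModule ω ε M)).restrictScalars K
      refine Submodule.span_le.2 ?_ h1
      rintro _ ⟨i, y, hy, rfl⟩
      rw [add_sub_cancel_right] at hy
      exact Submodule.smul_mem _ _ (Submodule.subset_span hy)
    obtain ⟨c, hc⟩ := h2
    refine ⟨hcomp (fun i => (ω i : ℤ)) (fun k => (e k : ℤ)) w
      (hcomp (fun _ => 1) (fun _ => a) (a + 1) c), ?_, hcomp_idem _ _, hsmall _ ?_⟩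
    · rw [← hcomp_lc hphom, ← hcomp_lc (s := fun _ => a) hdeg_p, hc,
        (mem_gpart.1 (mulVars_le_gpart _ h1)).2, hcomp_idem]
    · rw [hcomp_comm, hcomp_idem]
  -- Linearity is used here: only syzygies of degree `a + 1` need to be lifted.
  have hsyz : LinearMap.ker (lc p) ≤ initialModule ω e (LinearMap.ker (lc f)) := by
    refine (ker_le_span_of_linear hcp hlin).trans (Submodule.span_le.2 ?_)
    rintro x ⟨hx, hxa⟩
    rw [mem_degreePart] at hxa
    refine mem_initialModule.2 (mem_inn_ker (by simp) (by simp) hf hp hW hx fun w => hsmall _ ?_)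
    rw [hcomp_comm, hxa]
  rw [← range_lc_eq_generatedInDegree hfs, ← hL]
  refine le_antisymm (fun x hx => ?_) ?_
  · rw [mem_initialModule] at hx
    rw [← Submodule.restrictScalars_mem K]
    refine mem_of_hcomp_mem (fun i => (ω i : ℤ)) (fun k => (ε k : ℤ)) fun w => ?_
    obtain ⟨y, ⟨g, rfl⟩, h2, h3⟩ := hx w
    rw [← h3]
    exact hcomp_mem_range_of_syzygies_lift (by simp) (by simp) hf hp
      (fun s hs => mem_initialModule.1 (hsyz hs)) w g h2
  · rw [Fintype.range_linearCombination (MvPolynomial (Fin n) K) p, Submodule.span_le]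
    rintro _ ⟨k, rfl⟩
    refine mem_initialModule.2 ?_
    rw [← hp]
    exact hcomp_mem_inn ⟨Pi.single k 1, by simp⟩ (hf k)

end Main

end GradedFree

end

/-! ### Passage to componentwise linearity of M -/

theorem theorem5p4 {K : Type*} [Field K] (n m : ℕ)
    (D : Fin m → ℤ) (ω : Fin n → ℕ) (ε : Fin m → ℕ)
    (M : Submodule (MvPolynomial (Fin n) K) (Fin m → MvPolynomial (Fin n) K))
    (hM : GradedFree.IsGraded D M)
    (hlin : GradedFree.IsComponentwiseLinear D (GradedFree.initialModule ω ε M))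
    (hbetti : GradedFree.betti D M 0 = GradedFree.betti D (GradedFree.initialModule ω ε M) 0) :
    GradedFree.IsComponentwiseLinear D M := by
  intro a
  have ha := hlin a
  rw [GradedFree.regularity_le_iff, add_zero] at ha
  rw [GradedFree.regularity_le_iff, add_zero]
  have hin := GradedFree.initialModule_generatedInDegree hM hbetti ha
  intro i j hj
  refine GradedFree.gradedBetti_eq_zero_of_initialModule_linear ω i (ε := ε)
    (GradedFree.isGraded_generatedInDegree a) ?_ ?_ j hj
  · rw [hin]
    exact GradedFree.generatedInDegree_idem a
  · rw [hin]
    exact ha
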